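/- Let $p$ be a prime, $n\ge 1$, $\alpha,\beta>0$, and equip $\mathbb{Q}_p$ and $\mathbb{Q}_p^n$ with the Haar measures giving the closed unit balls mass $1$ and with $|x|_p=\max_j|x_j|_p$. Call a function $\varphi$ locally constant if there is $\ell\in\mathbb{Z}$ with $\varphi(x+y)=\varphi(x)$ for all $x$ and all $|y|_p\le p^{-\ell}$. Let $\mathcal{D}(\mathbb{Q}_p^m)$ be the space of compactly supported locally constant functions $\mathbb{Q}_p^m\to\mathbb{C}$, let $\Phi(\mathbb{Q}_p^m)=\{\varphi\in\mathcal{D}(\mathbb{Q}_p^m):\int\varphi\,dx=0\}$, and let $\Phi'(\mathbb{Q}_p^m)$ be its dual (every linear functional on $\Phi(\mathbb{Q}_p^m)$ is continuous). For test functions put $D^{\alpha,m}\varphi=\mathcal{F}^{-1}\big[|\xi|_p^{\alpha}\,\mathcal{F}\varphi\big]$, where $(\mathcal{F}\varphi)(\xi)=\int\chi_p(\xi\cdot x)\varphi(x)\,dx$ and $\chi_p(x)=e^{2\pi i\{x\}_p}$; write $D_t^\alpha$ for $D^{\alpha,1}$ in the variable $t\in\mathbb{Q}_p$ and $D_x^{\beta,n}$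 for $D^{\beta,n}$ in the variable $x\in\mathbb{Q}_p^n$. Let $\Phi'(\mathbb{Q}_p,\Phi'(\mathbb{Q}_p^n))$ be the space of linear maps $u:\Phi(\mathbb{Q}_p)\to\Phi'(\mathbb{Q}_p^n)$. Such a $u$ is a generalized solution of $D_t^\alpha u-D_x^{\beta,n}u=0$ if $$\langle\langle u,D_t^{\alpha}\varphi_1\rangle,\varphi_2\rangle=\langle\langle u,\varphi_1\rangle,D_x^{\beta,n}\varphi_2\rangle\qquad\text{for all }\varphi_1\in\Phi(\mathbb{Q}_p),\ \varphi_2\in\Phi(\mathbb{Q}_p^n),$$ and it is radial in $t$ if $\langle u,\varphi(\varepsilon\,\cdot)\rangle=\langle u,\varphi\rangle$ for all $\varphi\in\Phi(\mathbb{Q}_p)$ and all $\varepsilon\in\mathbb{Q}_p$ with $|\varepsilon|_p=1$. Let $\mathcal{D}(\mathbb{Q}_p,\Phi'(\mathbb{Q}_p^n))$ be the space of functions $f:\mathbb{Q}_p\to\Phi'(\mathbb{Q}_p^n)$ such that $t\mapsto\langle f(t),\varphi\rangle$ belongs to $\mathcal{D}(\mathbb{Q}_p)$ for every $\varphi\in\Phi(\mathbb{Q}_p^n)$.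 (1) Let $u\in\Phi'(\mathbb{Q}_p,\Phi'(\mathbb{Q}_p^n))$ be a generalized solution that is radial in $t$. Then $u\in\mathcal{D}(\mathbb{Q}_p,\Phi'(\mathbb{Q}_p^n))$: there is exactly one $f\in\mathcal{D}(\mathbb{Q}_p,\Phi'(\mathbb{Q}_p^n))$ with $\langle\langle u,\varphi_1\rangle,\varphi_2\rangle=\int_{\mathbb{Q}_p}\langle f(t),\varphi_2\rangle\varphi_1(t)\,dt$ for all $\varphi_1\in\Phi(\mathbb{Q}_p)$, $\varphi_2\in\Phi(\mathbb{Q}_p^n)$. If, in addition, $u(0,\cdot):=f(0)=0$, then $u=0$ and $f(t)=0$ for all $t$. (2) Let $u,v:\mathbb{Q}_p\times\mathbb{Q}_p^n\to\mathbb{C}$ be bounded locally constant functions that depend on $t$ only through $|t|_p$ and satisfy $D_t^\alpha w-D_x^{\beta,n}w=0$ ($w=u,v$) at every point, where on bounded locally constant functions $$(D^{\alpha,m}w)(x)=\frac{1-p^{\alpha}}{1-p^{-\alpha-m}}\int_{\mathbb{Q}_p^m}|y|_p^{-\alpha-m}\,[w(x-y)-w(x)]\,dy.$$ If $u(0,x)=v(0,x)$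 for all $x\in\mathbb{Q}_p^n$, then $u=v$. -/

import Mathlib

open MeasureTheory

noncomputable section

namespace PadicWave

section Haar

variable (p : ℕ) [Fact p.Prime]

/-- The Borel σ-algebra of `ℚ_p`. -/
instance instMeasurableSpacePadic : MeasurableSpace ℚ_[p] := borel ℚ_[p]

instance instBorelSpacePadic : BorelSpace ℚ_[p] := ⟨rfl⟩

/-- The closed unit ball `{x : |x|_p ≤ 1}`, a compact set with non-empty interior. -/
def unitBall : TopologicalSpace.PositiveCompacts ℚ_[p] where
  carrier := Metric.closedBall 0 1
  isCompact' := isCompact_closedBall 0 1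
  interior_nonempty' :=
    ⟨0, mem_interior_iff_mem_nhds.mpr (Metric.closedBall_mem_nhds 0 one_pos)⟩

/-- The Haar measure `dx` on `ℚ_p` with `∫_{|x|_p ≤ 1} dx = 1`. On `ℚ_pⁿ`, that is
`Fin n → ℚ_[p]` with `|x|_p = max_j |x_j|_p`, `volume` is then the product measure. -/
instance instMeasureSpacePadic : MeasureSpace ℚ_[p] where
  volume := Measure.addHaarMeasure (unitBall p)

instance instIsAddHaarMeasurePadic : (volume : Measure ℚ_[p]).IsAddHaarMeasure :=
  inferInstanceAs (Measure.addHaarMeasure (unitBall p)).IsAddHaarMeasure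

end Haar

section Character

variable {p : ℕ} [Fact p.Prime]

/-- `k = max(0, -γ(x))`, the number of digits of `x` in front of the `p`-adic point. -/
def fracDigits (x : ℚ_[p]) : ℕ := (-x.valuation).toNat

lemma norm_mul_pow_fracDigits_le (x : ℚ_[p]) : ‖x * (p : ℚ_[p]) ^ fracDigits x‖ ≤ 1 := by
  have hp : (1 : ℝ) < p := by exact_mod_cast (Fact.out : p.Prime).one_lt
  by_cases hx : x = 0
  · simp [hx]
  · rw [norm_mul, norm_pow, Padic.norm_p, Padic.norm_eq_zpow_neg_valuation hx, inv_pow,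
      ← zpow_natCast, ← zpow_neg, ← zpow_add₀ (by positivity)]
    refine zpow_le_one_of_nonpos₀ hp.le ?_
    have := Int.self_le_toNat (-x.valuation)
    unfold fracDigits
    omega

/-- The fractional part `{x}_p`: writing `x = p^{-k} y` with `k = max(0, -γ(x))` and `y ∈ ℤ_p`, it
is `p^{-k} (y_0 + y_1 p + ⋯ + y_{k-1} p^{k-1})` where the `y_j` are the `p`-adic digits of `y`. -/
def fracPart (x : ℚ_[p]) : ℚ :=
  (PadicInt.appr ⟨x * (p : ℚ_[p]) ^ fracDigits x, norm_mul_pow_fracDigits_le x⟩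
    (fracDigits x) : ℚ) / (p : ℚ) ^ fracDigits x

/-- The additive character `χ_p(x) = exp(2πi {x}_p)`. -/
def chi (x : ℚ_[p]) : ℂ := Complex.exp (2 * Real.pi * Complex.I * (fracPart x : ℂ))

end Character

section FunctionSpaces

variable (p : ℕ) (E : Type*) [NormedAddCommGroup E]

variable {E} in
/-- Local constancy: there is an integer `ℓ` with `φ(x + y) = φ(x)` for all `x` and all `y`
with `|y|_p ≤ p^{-ℓ}`. -/
def LocConst (φ : E → ℂ) : Prop :=
  ∃ ℓ : ℤ, ∀ x y : E, ‖y‖ ≤ (p : ℝ) ^ (-ℓ) → φ (x + y) = φ x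

variable [hp : Fact p.Prime]

variable {p E} in
lemma LocConst.continuous {φ : E → ℂ} (h : LocConst p φ) : Continuous φ := by
  obtain ⟨ℓ, hℓ⟩ := h
  have hp0 : (0 : ℝ) < p := by exact_mod_cast hp.out.pos
  refine IsLocallyConstant.continuous ((IsLocallyConstant.iff_eventually_eq φ).mpr fun x => ?_)
  filter_upwards [Metric.closedBall_mem_nhds x (zpow_pos hp0 (-ℓ))] with y hy
  have := hℓ x (y - x) (by simpa [dist_eq_norm] using hy)
  simpa using this

/-- The space `𝓓(E)` of locally constant functions `E → ℂ` with compact support. -/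
def testSpace : Submodule ℂ (E → ℂ) where
  carrier := {φ | LocConst p φ ∧ HasCompactSupport φ}
  zero_mem' := ⟨⟨0, fun _ _ _ => rfl⟩, HasCompactSupport.zero⟩
  add_mem' := by
    rintro φ ψ ⟨⟨k, hk⟩, hφ⟩ ⟨⟨l, hl⟩, hψ⟩
    have hp1 : (1 : ℝ) ≤ p := by exact_mod_cast hp.out.one_lt.le
    refine ⟨⟨max k l, fun x y hy => ?_⟩, hφ.add hψ⟩
    have h1 := hk x y (hy.trans (zpow_le_zpow_right₀ hp1 (neg_le_neg (le_max_left k l))))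
    have h2 := hl x y (hy.trans (zpow_le_zpow_right₀ hp1 (neg_le_neg (le_max_right k l))))
    simp only [Pi.add_apply, h1, h2]
  smul_mem' := by
    rintro c φ ⟨⟨k, hk⟩, hφ⟩
    refine ⟨⟨k, fun x y hy => ?_⟩, hφ.smul_left (f := fun _ => c)⟩
    simp only [Pi.smul_apply, hk x y hy]

variable [MeasureSpace E] [BorelSpace E] [IsFiniteMeasureOnCompacts (volume : Measure E)]

variable {p E} in
lemma integrable_of_mem_testSpace {φ : E → ℂ} (h : φ ∈ testSpace p E) : Integrable φ :=
  h.1.continuous.integrable_of_hasCompactSupport h.2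

/-- The Lizorkin space `Φ(E)` of test functions of the second kind: the `φ ∈ 𝓓(E)` with
`∫ φ = 0`. -/
def lizorkin : Submodule ℂ (E → ℂ) where
  carrier := {φ | φ ∈ testSpace p E ∧ ∫ x, φ x = 0}
  zero_mem' := ⟨zero_mem _, by simp⟩
  add_mem' := by
    rintro φ ψ ⟨hφ, hφ0⟩ ⟨hψ, hψ0⟩
    refine ⟨add_mem hφ hψ, ?_⟩
    simp only [Pi.add_apply]
    rw [integral_add (integrable_of_mem_testSpace hφ) (integrable_of_mem_testSpace hψ), hφ0, hψ0,
      add_zero]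
  smul_mem' := by
    rintro c φ ⟨hφ, hφ0⟩
    refine ⟨Submodule.smul_mem _ c hφ, ?_⟩
    simp only [Pi.smul_apply, smul_eq_mul]
    rw [integral_const_mul, hφ0, mul_zero]

end FunctionSpaces

section Operators

variable {p : ℕ} [Fact p.Prime] {E : Type*} [NormedAddCommGroup E] [MeasureSpace E]

/-- The Fourier transform `(𝓕φ)(ξ) = ∫ χ_p(ξ·x) φ(x) dx` for the pairing `ξ·x = B ξ x`. -/
def fourier (B : E → E → ℚ_[p]) (φ : E → ℂ) (ξ : E) : ℂ := ∫ x, chi (B ξ x) * φ x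

/-- The inverse Fourier transform `(𝓕⁻¹φ)(x) = ∫ χ_p(-x·ξ) φ(ξ) dξ`. -/
def fourierInv (B : E → E → ℚ_[p]) (φ : E → ℂ) (x : E) : ℂ := ∫ ξ, chi (-(B x ξ)) * φ ξ

/-- `𝓕⁻¹[|ξ|_p^α 𝓕φ]`. -/
def fracDiff (B : E → E → ℚ_[p]) (α : ℝ) (φ : E → ℂ) : E → ℂ :=
  fourierInv B fun ξ => ((‖ξ‖ ^ α : ℝ) : ℂ) * fourier B φ ξ

variable (p) in
/-- The hypersingular integral
`(1 - p^α) / (1 - p^{-α-d}) ∫ |y|_p^{-α-d} [u(x - y) - u(x)] dy` on a space of dimension `d`. -/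
def hypersingular (d : ℕ) (α : ℝ) (u : E → ℂ) (x : E) : ℂ :=
  (((1 - (p : ℝ) ^ α) / (1 - (p : ℝ) ^ (-α - d)) : ℝ) : ℂ) *
    ∫ y, ((‖y‖ ^ (-α - d) : ℝ) : ℂ) * (u (x - y) - u x)

end Operators

section Equation

variable (p : ℕ) [Fact p.Prime] (n : ℕ)

/-- The operator `D^α` on test functions on `ℚ_p`. -/
def Dtime (α : ℝ) : (ℚ_[p] → ℂ) → ℚ_[p] → ℂ := fracDiff (fun ξ x => ξ * x) α

/-- The Vladimirov–Taibleson operator `D^{β,n}` on test functions on `ℚ_pⁿ`. -/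
def Dspace (β : ℝ) : ((Fin n → ℚ_[p]) → ℂ) → (Fin n → ℚ_[p]) → ℂ :=
  fracDiff (fun ξ x => ξ ⬝ᵥ x) β

/-- `Φ(ℚ_p)`. -/
abbrev PhiTime : Type := lizorkin p ℚ_[p]

/-- `Φ(ℚ_pⁿ)`. -/
abbrev PhiSpace : Type := lizorkin p (Fin n → ℚ_[p])

/-- `Φ'(ℚ_pⁿ)`. The space `Φ(ℚ_pⁿ)` carries the inductive limit topology of the finite-dimensional
spaces of functions with fixed support ball and fixed exponent of local constancy, so every linear
functional on it is continuous, and the conjugate space is the algebraic dual. -/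
abbrev PhiSpaceDual : Type := Module.Dual ℂ (PhiSpace p n)

/-- `Φ'(ℚ_p, Φ'(ℚ_pⁿ))`: distributions over `Φ(ℚ_p)` with values in `Φ'(ℚ_pⁿ)`. Again every linear
map is continuous. -/
abbrev VectorDist : Type := PhiTime p →ₗ[ℂ] PhiSpaceDual p n

variable {p n}

/-- `⟨⟨u, D_t^α φ₁⟩, φ₂⟩ = ⟨⟨u, φ₁⟩, D_x^{β,n} φ₂⟩` for all `φ₁ ∈ Φ(ℚ_p)`, `φ₂ ∈ Φ(ℚ_pⁿ)`. Here
`ψ₁` and `ψ₂` are names for the functions `D_t^α φ₁` and `D_x^{β,n} φ₂`, which lie in `Φ`. -/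
def IsGeneralizedSolution (α β : ℝ) (u : VectorDist p n) : Prop :=
  ∀ (φ₁ ψ₁ : PhiTime p) (φ₂ ψ₂ : PhiSpace p n),
    (ψ₁ : ℚ_[p] → ℂ) = Dtime p α φ₁ → (ψ₂ : (Fin n → ℚ_[p]) → ℂ) = Dspace p n β φ₂ →
    u ψ₁ φ₂ = u φ₁ ψ₂

/-- `u` is radial in `t`: it is invariant under `t ↦ ε t` for every `ε` with `|ε|_p = 1`, i.e.
`⟨u, φ(ε ·)⟩ = ⟨u, φ⟩` for all `φ ∈ Φ(ℚ_p)`. Here `ψ` is a name for `φ(ε ·)`, which lies in `Φ`. -/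
def IsRadialDist (u : VectorDist p n) : Prop :=
  ∀ ε : ℚ_[p], ‖ε‖ = 1 → ∀ φ ψ : PhiTime p,
    ((ψ : ℚ_[p] → ℂ) = fun t => (φ : ℚ_[p] → ℂ) (ε * t)) → u ψ = u φ

/-- `f ∈ 𝓓(ℚ_p, Φ'(ℚ_pⁿ))`: the function `t ↦ ⟨f(t), φ⟩` is in `𝓓(ℚ_p)` for every
`φ ∈ Φ(ℚ_pⁿ)`. -/
def IsVectorTest (f : ℚ_[p] → PhiSpaceDual p n) : Prop :=
  ∀ φ : PhiSpace p n, (fun t => f t φ) ∈ testSpace p ℚ_[p]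

/-- The distribution `u` is given by the function `f`:
`⟨⟨u, φ₁⟩, φ₂⟩ = ∫ ⟨f(t), φ₂⟩ φ₁(t) dt`. -/
def IsGivenBy (u : VectorDist p n) (f : ℚ_[p] → PhiSpaceDual p n) : Prop :=
  ∀ (φ₁ : PhiTime p) (φ₂ : PhiSpace p n),
    u φ₁ φ₂ = ∫ t : ℚ_[p], f t φ₂ * (φ₁ : ℚ_[p] → ℂ) t

/-- A bounded, locally constant function `u(t, x)` on `ℚ_p × ℚ_pⁿ`, radial in `t`, that satisfies
`D_t^α u - D_x^{β,n} u = 0` at every point, with the operators understood as hypersingular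
integrals (these converge absolutely for bounded locally constant functions). -/
structure IsRadialBoundedSolution (α β : ℝ) (u : ℚ_[p] → (Fin n → ℚ_[p]) → ℂ) : Prop where
  bounded : ∃ C : ℝ, ∀ t x, ‖u t x‖ ≤ C
  locConst : LocConst p (fun z : ℚ_[p] × (Fin n → ℚ_[p]) => u z.1 z.2)
  radial : ∀ s t : ℚ_[p], ‖s‖ = ‖t‖ → u s = u t
  equation : ∀ t x,
    hypersingular p 1 α (fun s => u s x) t - hypersingular p n β (u t) x = 0

end Equation

end PadicWave

end

/-! Averaging over balls takes the place of spectral theory. In an ultrametric space an average over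
balls of radius r is invariant under translations by that ball, so the difference of the averages of
radii `p^(-M)` and `p^(1-M)` isolates one frequency: its Fourier transform lives on the sphere of
radius `p^M`, and the fractional operators act on it as scalars.

For distributions, every Lizorkin function is a finite sum of such components
(`exists_sum_scaleProj`), and D^α multiplies a component by `p^(Mα)` (`HasFrequency.fracDiff_eq`).
Hence a generalized solution pairs frequencies M in time and N in space to zero unless `p^(Mα) =
p^(Nβ)`, and each N matches at most one M. Radial functions of frequency M form a line spanned by a
kernel e_M, so averaging over units gives u(ψ) = (ψ(0)/e_M(0)) u(e_M) on that frequency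
(`IsRadialDist.eq_smul`). As e_M reproduces the value at 0 of the M-component, u is given by f(t) =
∑ (e_M(t)/e_M(0)) u(e_M), a finite sum against each test function. Testing f(0) = ∑ u(e_M) on one
spatial frequency leaves at most one term, so f(0) = 0 forces every u(e_M) to vanish.

For bounded functions, let w be the difference of the two solutions. Its spatial components solve
the same equation and are eigenfunctions of the space operator, so for fixed x they are radial
eigenfunctions of the time operator vanishing at t = 0. These are zero by a positivity argument
(`integral_kernel_ne_zero`): the eigenvalue is fixed by the smallest sphere on which the function is
nonzero, and propagating signs outwards makes it nonnegative after normalization, against the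
vanishing of the operator at the origin. Once all components vanish, w is constant in x, and the
same argument with eigenvalue 0 finishes. -/

noncomputable section

namespace PadicWave

set_option linter.unusedSectionVars false

/-! ### Averages over ultrametric balls -/

section Averages

open Metric

variable {E : Type*} [NormedAddCommGroup E]

/-- Invariance under translations by the elements of the closed ball of radius `r`. -/
def BallInvariant (r : ℝ) (g : E → ℂ) : Prop := ∀ x y : E, ‖y‖ ≤ r → g (x + y) = g x

lemma BallInvariant.mono {r s : ℝ} {g : E → ℂ} (h : BallInvariant s g) (hrs : r ≤ s) :
    BallInvariant r g := fun x y hy => h x y (hy.trans hrs)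

lemma BallInvariant.eq_of_norm_sub_le {r : ℝ} {g : E → ℂ} (h : BallInvariant r g) {x y : E}
    (hxy : ‖x - y‖ ≤ r) : g x = g y := by
  simpa using h y (x - y) hxy

lemma BallInvariant.sub {r : ℝ} {f g : E → ℂ} (hf : BallInvariant r f) (hg : BallInvariant r g) :
    BallInvariant r (fun x => f x - g x) := fun x y hy => by
  simp only [hf x y hy, hg x y hy]

lemma BallInvariant.continuous {r : ℝ} (hr : 0 < r) {g : E → ℂ} (h : BallInvariant r g) :
    Continuous g := by
  refine IsLocallyConstant.continuous ((IsLocallyConstant.iff_eventually_eq g).mpr fun x => ?_)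
  filter_upwards [closedBall_mem_nhds x hr] with y hy
  exact h.eq_of_norm_sub_le (by simpa [dist_eq_norm] using hy)

variable [MeasureSpace E]

/-- The average of `g` over the closed ball of radius `r` around `x`. -/
def ballAvg (r : ℝ) (g : E → ℂ) (x : E) : ℂ :=
  ((volume.real (closedBall (0 : E) r) : ℝ) : ℂ)⁻¹ * ∫ y in closedBall x r, g y

/-- Every point of an ultrametric ball is a centre of it. -/
lemma ballInvariant_ballAvg [IsUltrametricDist E] (r : ℝ) (g : E → ℂ) :
    BallInvariant r (ballAvg r g) := by
  intro x y hy
  have : closedBall (x + y) r = closedBall x r :=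
    (IsUltrametricDist.closedBall_eq_of_mem (by simpa using hy)).symm
  rw [ballAvg, ballAvg, this]

variable [BorelSpace E] [ProperSpace E] [(volume : Measure E).IsAddHaarMeasure]

lemma volume_closedBall_pos {r : ℝ} (hr : 0 < r) : 0 < volume.real (closedBall (0 : E) r) :=
  ENNReal.toReal_pos (measure_closedBall_pos volume 0 hr).ne'
    (isCompact_closedBall 0 r).measure_lt_top.ne

lemma setIntegral_closedBall_add (r : ℝ) (g : E → ℂ) (x : E) :
    ∫ y in closedBall x r, g y = ∫ z in closedBall (0 : E) r, g (x + z) := by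
  rw [← (measurePreserving_add_left volume x).setIntegral_preimage_emb
    (MeasurableEquiv.addLeft x).measurableEmbedding]
  congr 2
  ext z
  simp

lemma setIntegral_closedBall_sub (r : ℝ) (g : E → ℂ) (x : E) :
    ∫ y in closedBall x r, g y = ∫ z in closedBall (0 : E) r, g (x - z) := by
  have h := (Measure.measurePreserving_sub_left volume x).setIntegral_preimage_emb
    (MeasurableEquiv.subLeft x).measurableEmbedding g (closedBall x r)
  rw [← h]
  congr 2
  ext z
  simp [dist_eq_norm]

lemma ballAvg_eq_add (r : ℝ) (g : E → ℂ) (x : E) : ballAvg r g x =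
    ((volume.real (closedBall (0 : E) r) : ℝ) : ℂ)⁻¹ * ∫ z in closedBall (0 : E) r, g (x + z) := by
  rw [ballAvg, setIntegral_closedBall_add]

lemma ballAvg_comp_sub_left (r : ℝ) (g : E → ℂ) (a x : E) :
    ballAvg r (fun y => g (a - y)) x = ballAvg r g (a - x) := by
  rw [ballAvg_eq_add, ballAvg, setIntegral_closedBall_sub r g (a - x)]
  simp only [← sub_sub]

lemma ballAvg_const {r : ℝ} (hr : 0 < r) (c : ℂ) (x : E) : ballAvg r (fun _ => c) x = c := by
  rw [ballAvg_eq_add, setIntegral_const, Complex.real_smul, inv_mul_cancel_left₀]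
  exact_mod_cast (volume_closedBall_pos (E := E) hr).ne'

lemma ballAvg_congr {r : ℝ} {f g : E → ℂ} {x : E} (h : ∀ y, ‖y - x‖ ≤ r → f y = g y) :
    ballAvg r f x = ballAvg r g x := by
  rw [ballAvg, ballAvg, setIntegral_congr_fun measurableSet_closedBall fun y hy =>
    h y (by simpa [dist_eq_norm] using hy)]

lemma BallInvariant.ballAvg_eq {r : ℝ} (hr : 0 < r) {g : E → ℂ} (h : BallInvariant r g) :
    ballAvg r g = g := by
  ext x
  rw [ballAvg_congr fun y hy => h.eq_of_norm_sub_le hy, ballAvg_const hr]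

lemma ballAvg_sub (r : ℝ) {f g : E → ℂ} (hf : Continuous f) (hg : Continuous g) (x : E) :
    ballAvg r (fun y => f y - g y) x = ballAvg r f x - ballAvg r g x := by
  rw [ballAvg, integral_sub, mul_sub, ballAvg, ballAvg]
  · exact hf.continuousOn.integrableOn_compact (isCompact_closedBall x r)
  · exact hg.continuousOn.integrableOn_compact (isCompact_closedBall x r)

lemma norm_ballAvg_le {r : ℝ} (hr : 0 < r) {g : E → ℂ} {C : ℝ} (hC : ∀ x, ‖g x‖ ≤ C) (x : E) :
    ‖ballAvg r g x‖ ≤ C := by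
  have hv := volume_closedBall_pos (E := E) hr
  rw [ballAvg_eq_add, norm_mul, norm_inv, Complex.norm_real, Real.norm_of_nonneg hv.le,
    inv_mul_le_iff₀ hv, mul_comm]
  exact norm_setIntegral_le_of_norm_le_const (isCompact_closedBall 0 r).measure_lt_top
    fun y _ => hC _

/-- Averaging over balls is adjoint to multiplication by functions invariant under the ball. -/
lemma integral_mul_ballAvg {r : ℝ} (hr : 0 < r) {k g : E → ℂ} (hk : BallInvariant r k)
    (hkg : Integrable fun x => k x * g x) : ∫ x, k x * ballAvg r g x = ∫ x, k x * g x := by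
  have hv : ((volume.real (closedBall (0 : E) r) : ℝ) : ℂ) ≠ 0 := by
    exact_mod_cast (volume_closedBall_pos (E := E) hr).ne'
  have hf : Integrable ((closedBall (0 : E) r).indicator fun _ => (1 : ℂ)) :=
    (integrable_indicator_iff measurableSet_closedBall).mpr
      (integrableOn_const (isCompact_closedBall 0 r).measure_lt_top.ne)
  -- The convolution of the ball's indicator with k·g is integrated in two ways: as a product of
  -- integrals, and pointwise, where k is constant on each ball and comes out.
  have h := integral_convolution (L := ContinuousLinearMap.mul ℂ ℂ) hf hkg
  simp only [convolution_def, ContinuousLinearMap.mul_apply'] at h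
  rw [integral_indicator measurableSet_closedBall, setIntegral_const, Complex.real_smul,
    mul_one] at h
  have key : ∀ x, ∫ t, (closedBall (0 : E) r).indicator (fun _ => (1 : ℂ)) t *
      (k (x - t) * g (x - t)) =
      ((volume.real (closedBall (0 : E) r) : ℝ) : ℂ) * (k x * ballAvg r g x) := by
    intro x
    rw [mul_left_comm, ballAvg, mul_inv_cancel_left₀ hv, setIntegral_closedBall_sub,
      ← integral_const_mul, ← integral_indicator measurableSet_closedBall]
    congr 1
    ext t
    by_cases ht : t ∈ closedBall (0 : E) r
    · rw [Set.indicator_of_mem ht, Set.indicator_of_mem ht, one_mul,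
        hk.eq_of_norm_sub_le (x := x - t) (y := x) (by simpa using ht)]
    · simp [Set.indicator_of_notMem ht]
  simp only [key] at h
  rw [integral_const_mul] at h
  exact mul_left_cancel₀ hv h

lemma integral_mul_eq_zero {r : ℝ} (hr : 0 < r) {k g : E → ℂ} (hk : BallInvariant r k)
    (hkg : Integrable fun x => k x * g x) (hg : ∀ x, ballAvg r g x = 0) :
    ∫ x, k x * g x = 0 := by
  rw [← integral_mul_ballAvg hr hk hkg]
  simp [hg]

variable [IsUltrametricDist E]

lemma ballInvariant_indicator_closedBall {r q : ℝ} (hrq : r ≤ q) (x : E) (c : ℂ) :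
    BallInvariant r ((closedBall x q).indicator fun _ => c) := by
  intro a y hy
  have h1 : closedBall (a + y) q = closedBall a q :=
    (IsUltrametricDist.closedBall_eq_of_mem (by simpa using hy.trans hrq)).symm
  have h2 : a + y ∈ closedBall x q ↔ a ∈ closedBall x q := by
    rw [mem_closedBall_comm, h1, mem_closedBall_comm]
  by_cases ha : a ∈ closedBall x q
  · rw [Set.indicator_of_mem ha, Set.indicator_of_mem (h2.mpr ha)]
  · rw [Set.indicator_of_notMem ha, Set.indicator_of_notMem (mt h2.mp ha)]

lemma ballAvg_eq_integral_indicator (r : ℝ) (g : E → ℂ) (x : E) :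
    ballAvg r g x = ∫ y, (closedBall x r).indicator
      (fun _ => ((volume.real (closedBall (0 : E) r) : ℝ) : ℂ)⁻¹) y * g y := by
  rw [ballAvg, ← integral_const_mul, ← integral_indicator measurableSet_closedBall]
  simp only [Set.indicator_mul_left]

lemma integrable_indicator_closedBall_mul (r : ℝ) (c : ℂ) {g : E → ℂ} (hg : Continuous g)
    (x : E) : Integrable fun y => (closedBall x r).indicator (fun _ => c) y * g y := by
  simp only [← Set.indicator_mul_left]
  exact (integrable_indicator_iff measurableSet_closedBall).mpr
    ((continuous_const.mul hg).continuousOn.integrableOn_compact (isCompact_closedBall x r))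

/-- The indicator of a ball of radius q is invariant under the smaller radius r, so the adjointness
of averaging applies to it. -/
lemma ballAvg_ballAvg {r q : ℝ} (hr : 0 < r) (hrq : r ≤ q) {g : E → ℂ} (hg : Continuous g) :
    ballAvg q (ballAvg r g) = ballAvg q g := by
  ext x
  rw [ballAvg_eq_integral_indicator, ballAvg_eq_integral_indicator]
  exact integral_mul_ballAvg hr (ballInvariant_indicator_closedBall hrq x _)
    (integrable_indicator_closedBall_mul q _ hg x)

lemma continuous_ballAvg {r : ℝ} (hr : 0 < r) (g : E → ℂ) : Continuous (ballAvg r g) :=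
  (ballInvariant_ballAvg r g).continuous hr

lemma ballAvg_sub_ballAvg_eq_zero {r q : ℝ} (hr : 0 < r) (hrq : r ≤ q) {g : E → ℂ}
    (hg : Continuous g) (x : E) :
    ballAvg q (fun y => ballAvg r g y - ballAvg q g y) x = 0 := by
  have hq := hr.trans_le hrq
  rw [ballAvg_sub q (continuous_ballAvg hr g) (continuous_ballAvg hq g),
    ballAvg_ballAvg hr hrq hg, ballAvg_ballAvg hq le_rfl hg, sub_self]

/-- A locally constant function whose averages over balls do not depend on the radius of the
ball is constant. -/
lemma LocConst.eq_of_ballAvg_eq {p : ℕ} [hp : Fact p.Prime] {g : E → ℂ} (hg : LocConst p g)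
    (h : ∀ (N : ℤ) (x : E),
      ballAvg ((p : ℝ) ^ (-N)) g x = ballAvg ((p : ℝ) ^ (1 - N)) g x) (x y : E) : g x = g y := by
  obtain ⟨ℓ, hℓ⟩ := hg
  have hp1 : (1 : ℝ) < p := by exact_mod_cast hp.out.one_lt
  have hp0 : (0 : ℝ) < p := one_pos.trans hp1
  -- Starting from the radius of local constancy, each step enlarges the radius by p; g is then
  -- invariant under arbitrarily large balls.
  have hm : ∀ m : ℕ, ballAvg ((p : ℝ) ^ ((m : ℤ) - ℓ)) g = g := by
    intro m
    induction m with
    | zero => simpa using BallInvariant.ballAvg_eq (zpow_pos hp0 _) hℓ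
    | succ m ih =>
      ext x
      have := h (ℓ - m) x
      rw [neg_sub, ih] at this
      rw [this]
      push_cast
      ring_nf
  obtain ⟨m, hm'⟩ := pow_unbounded_of_one_lt (‖x - y‖ * (p : ℝ) ^ ℓ) hp1
  have hinv := ballInvariant_ballAvg ((p : ℝ) ^ ((m : ℤ) - ℓ)) g
  rw [hm m] at hinv
  refine hinv.eq_of_norm_sub_le ?_
  rw [zpow_sub₀ hp0.ne', le_div_iff₀ (zpow_pos hp0 _), zpow_natCast]
  exact hm'.le

end Averages

/-! ### Norm values and ball volumes in `ℚ_p` and `ℚ_pⁿ` -/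

section Geometry

open Metric

/-- The norm takes its values in the powers of `p`, and the ball of radius `p ^ k` has volume
`p ^ (d k)`: the properties of `ℚ_p^d` that the hypersingular integrals depend on. -/
structure IsPadicSpace (p d : ℕ) (E : Type*) [NormedAddCommGroup E] [MeasureSpace E] : Prop where
  exists_norm_eq : ∀ x : E, x ≠ 0 → ∃ k : ℤ, ‖x‖ = (p : ℝ) ^ k
  volume_closedBall : ∀ k : ℤ,
    volume.real (closedBall (0 : E) ((p : ℝ) ^ k)) = (p : ℝ) ^ ((d : ℤ) * k)

variable {p : ℕ} [hp : Fact p.Prime]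

variable (p) in
lemma one_lt_prime_cast : (1 : ℝ) < p := by exact_mod_cast hp.out.one_lt

variable (p) in
lemma prime_cast_pos : (0 : ℝ) < p := one_pos.trans (one_lt_prime_cast p)

/-- Rescaling by `p^(k+1)` turns the large ball into `ℤ_p`, and the pieces into its residue classes
mod p. -/
lemma closedBall_succ_eq_iUnion (k : ℤ) :
    closedBall (0 : ℚ_[p]) ((p : ℝ) ^ (k + 1)) =
      ⋃ a ∈ Finset.range p, closedBall ((a : ℚ_[p]) * (p : ℚ_[p]) ^ (-(k + 1))) ((p : ℝ) ^ k) := by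
  have hp0 := prime_cast_pos p
  have hpp : (p : ℚ_[p]) ≠ 0 := by exact_mod_cast hp.out.ne_zero
  ext x
  simp only [mem_closedBall, dist_eq_norm, sub_zero, Set.mem_iUnion, Finset.mem_range, exists_prop]
  constructor
  · intro hx
    have hy : ‖x * (p : ℚ_[p]) ^ (k + 1)‖ ≤ 1 := by
      rw [norm_mul, Padic.norm_p_zpow, zpow_neg, ← div_eq_mul_inv, div_le_one (zpow_pos hp0 _)]
      exact hx
    obtain ⟨z, hz⟩ : ∃ z : ℤ_[p], (z : ℚ_[p]) = x * (p : ℚ_[p]) ^ (k + 1) := ⟨⟨_, hy⟩, rfl⟩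
    have hlt' := PadicInt.norm_sub_zmodRepr_lt_one z
    set a := PadicInt.zmodRepr z
    refine ⟨a, PadicInt.zmodRepr_lt_p _, ?_⟩
    rw [PadicInt.norm_def, PadicInt.coe_sub, PadicInt.coe_natCast, hz] at hlt'
    have hle : ‖x * (p : ℚ_[p]) ^ (k + 1) - a‖ ≤ (p : ℝ) ^ (-1 : ℤ) := by
      rw [Padic.norm_le_pow_iff_norm_lt_pow_add_one]
      simpa using hlt'
    have : x - a * (p : ℚ_[p]) ^ (-(k + 1)) =
        (x * (p : ℚ_[p]) ^ (k + 1) - a) * (p : ℚ_[p]) ^ (-(k + 1)) := by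
      rw [sub_mul, mul_assoc, ← zpow_add₀ hpp]
      simp
    rw [this, norm_mul, Padic.norm_p_zpow, neg_neg]
    calc _ ≤ (p : ℝ) ^ (-1 : ℤ) * (p : ℝ) ^ (k + 1) := by gcongr
      _ = (p : ℝ) ^ k := by rw [← zpow_add₀ hp0.ne']; congr 1; ring
  · rintro ⟨a, -, ha⟩
    have h1 : ‖(a : ℚ_[p]) * (p : ℚ_[p]) ^ (-(k + 1))‖ ≤ (p : ℝ) ^ (k + 1) := by
      rw [norm_mul, Padic.norm_p_zpow, neg_neg]
      exact mul_le_of_le_one_left (zpow_pos hp0 _).le (by exact_mod_cast Padic.norm_int_le_one a)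
    have h2 : ‖x - (a : ℚ_[p]) * (p : ℚ_[p]) ^ (-(k + 1))‖ ≤ (p : ℝ) ^ (k + 1) :=
      ha.trans (zpow_le_zpow_right₀ (one_lt_prime_cast p).le (by omega))
    have := IsUltrametricDist.norm_add_le_max (x - (a : ℚ_[p]) * (p : ℚ_[p]) ^ (-(k + 1)))
      ((a : ℚ_[p]) * (p : ℚ_[p]) ^ (-(k + 1)))
    rw [sub_add_cancel] at this
    exact this.trans (max_le h2 h1)

lemma pairwiseDisjoint_closedBall (k : ℤ) : (↑(Finset.range p) : Set ℕ).PairwiseDisjoint fun a =>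
    closedBall ((a : ℚ_[p]) * (p : ℚ_[p]) ^ (-(k + 1))) ((p : ℝ) ^ k) := by
  intro a ha b hb hab
  have hp1 := one_lt_prime_cast p
  refine (IsUltrametricDist.closedBall_eq_or_disjoint _ _ _).resolve_left fun h => ?_
  have hmem : (a : ℚ_[p]) * (p : ℚ_[p]) ^ (-(k + 1)) ∈
      closedBall ((b : ℚ_[p]) * (p : ℚ_[p]) ^ (-(k + 1))) ((p : ℝ) ^ k) := by
    rw [← h]; exact mem_closedBall_self (zpow_pos (prime_cast_pos p) _).le
  rw [mem_closedBall, dist_eq_norm, ← sub_mul, norm_mul, Padic.norm_p_zpow, neg_neg] at hmem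
  have hone : ‖((a : ℚ_[p]) - b)‖ = 1 := by
    have : ‖(((a : ℤ) - b : ℤ) : ℚ_[p])‖ = 1 := by
      refine le_antisymm (Padic.norm_int_le_one _) (not_lt.mp fun hlt => ?_)
      rw [Padic.norm_intCast_lt_one_iff] at hlt
      simp only [Finset.coe_range, Set.mem_Iio] at ha hb
      have := Int.eq_zero_of_abs_lt_dvd hlt (by rw [abs_lt]; omega)
      omega
    simpa using this
  rw [hone, one_mul] at hmem
  exact absurd hmem (not_le.mpr (zpow_lt_zpow_right₀ hp1 (by omega)))

lemma volume_closedBall_eq (E : Type*) [NormedAddCommGroup E] [MeasureSpace E] [BorelSpace E]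
    [ProperSpace E] [(volume : Measure E).IsAddHaarMeasure] (x : E) (r : ℝ) :
    volume.real (closedBall x r) = volume.real (closedBall (0 : E) r) := by
  rw [Measure.real, ← measure_preimage_add volume x, Measure.real]
  congr 2
  ext z
  simp

variable (p) in
lemma volume_closedBall_padic_succ (k : ℤ) :
    volume.real (closedBall (0 : ℚ_[p]) ((p : ℝ) ^ (k + 1))) =
      p * volume.real (closedBall (0 : ℚ_[p]) ((p : ℝ) ^ k)) := by
  rw [closedBall_succ_eq_iUnion, measureReal_biUnion_finset (pairwiseDisjoint_closedBall k)
    (fun _ _ => measurableSet_closedBall)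
    (fun _ _ => (isCompact_closedBall _ _).measure_lt_top.ne)]
  simp [volume_closedBall_eq]

variable (p) in
lemma volume_closedBall_padic (k : ℤ) :
    volume.real (closedBall (0 : ℚ_[p]) ((p : ℝ) ^ k)) = (p : ℝ) ^ k := by
  have hp0 := (prime_cast_pos p).ne'
  induction k with
  | zero =>
    rw [zpow_zero, Measure.real]
    have : volume (closedBall (0 : ℚ_[p]) 1) = 1 := Measure.addHaarMeasure_self (K₀ := unitBall p)
    simp [this]
  | succ k ih => rw [volume_closedBall_padic_succ, ih, zpow_add_one₀ hp0, mul_comm]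
  | pred k ih =>
    have := volume_closedBall_padic_succ p (-(k : ℤ) - 1)
    rw [sub_add_cancel, ih] at this
    refine mul_left_cancel₀ hp0 (this.symm.trans ?_)
    rw [zpow_sub_one₀ hp0, mul_left_comm, mul_inv_cancel₀ hp0, mul_one]

variable (p) in
lemma isPadicSpace_padic : IsPadicSpace p 1 ℚ_[p] where
  exists_norm_eq x hx := ⟨_, Padic.norm_eq_zpow_neg_valuation hx⟩
  volume_closedBall k := by simpa using volume_closedBall_padic p k

lemma exists_norm_apply_eq {ι : Type*} [Fintype ι] [Nonempty ι] (x : ι → ℚ_[p]) :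
    ∃ i, ‖x i‖ = ‖x‖ := by
  obtain ⟨i, -, hi⟩ := Finset.exists_mem_eq_sup Finset.univ Finset.univ_nonempty
    fun i => ‖x i‖₊
  exact ⟨i, by rw [Pi.norm_def, hi, coe_nnnorm]⟩

variable (p) in
lemma isPadicSpace_pi (n : ℕ) : IsPadicSpace p n (Fin n → ℚ_[p]) where
  exists_norm_eq x hx := by
    have hne : Nonempty (Fin n) := by
      by_contra h
      rw [not_nonempty_iff] at h
      exact hx (Subsingleton.elim _ _)
    obtain ⟨i, hi⟩ := exists_norm_apply_eq x
    rw [← hi]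
    refine ⟨_, Padic.norm_eq_zpow_neg_valuation fun h0 => hx ?_⟩
    rw [← norm_eq_zero, ← hi, h0, norm_zero]
  volume_closedBall k := by
    rw [Measure.real, volume_pi_closedBall _ (zpow_pos (prime_cast_pos p) _).le,
      ENNReal.toReal_prod]
    have := volume_closedBall_padic p k
    rw [Measure.real] at this
    simp [this, mul_comm (n : ℤ) k, zpow_mul]

end Geometry

/-! ### The truncated kernel and its integrability -/

section Kernel

open Metric

variable {p : ℕ} [hp : Fact p.Prime] {E : Type*} [NormedAddCommGroup E] [MeasureSpace E]
  [BorelSpace E] [ProperSpace E] [(volume : Measure E).IsAddHaarMeasure] [IsUltrametricDist E]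

/-- The kernel `|y|^(-α - d)` cut off at the radius `r`. -/
def truncKernel (d : ℕ) (α r : ℝ) (y : E) : ℝ := (max r ‖y‖) ^ (-α - d)

lemma truncKernel_nonneg (d : ℕ) (α : ℝ) {r : ℝ} (hr : 0 < r) (y : E) :
    0 ≤ truncKernel d α r y := Real.rpow_nonneg (hr.le.trans (le_max_left _ _)) _

lemma continuous_truncKernel (d : ℕ) (α : ℝ) {r : ℝ} (hr : 0 < r) :
    Continuous (truncKernel d α r : E → ℝ) := by
  unfold truncKernel
  refine Continuous.rpow_const (by fun_prop) fun x => Or.inl ?_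
  exact (hr.trans_le (le_max_left _ _)).ne'

lemma max_norm_add_eq {r : ℝ} (x y : E) (hy : ‖y‖ ≤ r) : max r ‖x + y‖ = max r ‖x‖ := by
  refine le_antisymm (max_le (le_max_left _ _) ?_) (max_le (le_max_left _ _) ?_)
  · exact (IsUltrametricDist.norm_add_le_max x y).trans
      (max_le (le_max_right _ _) (hy.trans (le_max_left _ _)))
  · have := IsUltrametricDist.norm_add_le_max (x + y) (-y)
    rw [add_neg_cancel_right, norm_neg] at this
    exact this.trans (max_le (le_max_right _ _) (hy.trans (le_max_left _ _)))

lemma norm_eq_of_norm_sub_lt {x y : E} (h : ‖x - y‖ < ‖y‖) : ‖x‖ = ‖y‖ := by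
  rw [← norm_neg y]
  refine IsUltrametricDist.norm_eq_of_add_norm_lt_max ?_
  rw [← sub_eq_add_neg, norm_neg]
  exact h.trans_le (le_max_right _ _)

lemma truncKernel_add (d : ℕ) (α : ℝ) {r : ℝ} (x y : E) (hy : ‖y‖ ≤ r) :
    truncKernel d α r (x + y) = truncKernel d α r x := by
  rw [truncKernel, truncKernel, max_norm_add_eq x y hy]

lemma truncKernel_of_le (d : ℕ) (α : ℝ) {r : ℝ} {y : E} (hy : r ≤ ‖y‖) :
    truncKernel d α r y = ‖y‖ ^ (-α - d) := by
  rw [truncKernel, max_eq_right hy]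

lemma exists_zpow_lt {r : ℝ} (hr : 0 < r) : ∃ k : ℤ, (p : ℝ) ^ k < r := by
  obtain ⟨m, hm⟩ := exists_pow_lt_of_lt_one hr (inv_lt_one_of_one_lt₀ (one_lt_prime_cast p))
  exact ⟨-m, by simpa using hm⟩

lemma exists_le_zpow (p : ℕ) [hp : Fact p.Prime] (r : ℝ) : ∃ m : ℕ, r ≤ (p : ℝ) ^ m := by
  obtain ⟨m, hm⟩ := pow_unbounded_of_one_lt r (one_lt_prime_cast p)
  exact ⟨m, hm.le⟩

/-- On the shell of radius `p^(k+i)` the volume growth `p^(d(k+i))` cancels all of the decay except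
`p^(-α(k+i))`, which leaves a geometric series. -/
lemma integrable_truncKernel {d : ℕ} (hE : IsPadicSpace p d E) {α : ℝ} (hα : 0 < α) {r : ℝ}
    (hr : 0 < r) : Integrable (truncKernel d α r : E → ℝ) := by
  have hp0 := prime_cast_pos p
  have hp1 := one_lt_prime_cast p
  obtain ⟨k, hk⟩ := exists_zpow_lt (p := p) hr
  -- The piece i = 0 is the whole ball of radius `p^k < r`, so that the origin is covered; the
  -- others are shells.
  let s : ℕ → Set E := fun i => closedBall 0 ((p : ℝ) ^ (k + i)) \
    {y | i ≠ 0 ∧ ‖y‖ ≤ (p : ℝ) ^ (k + i - 1)}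
  have hcont := continuous_truncKernel (E := E) d α hr
  have hmeas : ∀ i, MeasurableSet (s i) := fun i => by
    refine measurableSet_closedBall.diff ?_
    by_cases hi : i = 0
    · simp [hi]
    · simp only [hi, ne_eq, not_false_eq_true, true_and]
      exact (isClosed_le continuous_norm continuous_const).measurableSet
  have hunion : Set.iUnion s = Set.univ := by
    refine Set.eq_univ_of_forall fun y => ?_
    have hex : ∃ i : ℕ, ‖y‖ ≤ (p : ℝ) ^ (k + i) := by
      obtain ⟨m, hm⟩ := exists_le_zpow p (‖y‖ * (p : ℝ) ^ (-k))
      refine ⟨m, ?_⟩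
      rw [zpow_neg, ← div_eq_mul_inv, div_le_iff₀ (zpow_pos hp0 _)] at hm
      rw [zpow_add₀ hp0.ne', zpow_natCast, mul_comm]
      exact hm
    classical
    refine Set.mem_iUnion.mpr ⟨Nat.find hex, by simpa using Nat.find_spec hex, ?_⟩
    rintro ⟨h0, hle⟩
    refine Nat.find_min hex (Nat.pred_lt h0) ?_
    convert hle using 2
    have := Nat.pos_of_ne_zero h0
    rw [Nat.pred_eq_sub_one, Nat.cast_sub (by omega)]
    push_cast
    ring
  rw [← integrableOn_univ, ← hunion]
  have hint : ∀ i, IntegrableOn (truncKernel d α r : E → ℝ) (s i) := fun i =>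
    (hcont.continuousOn.integrableOn_compact (isCompact_closedBall 0 _)).mono_set
      Set.sdiff_subset
  refine integrableOn_iUnion_of_summable_integral_norm hint ?_
  have hbound : ∀ i, ∫ x in s i, ‖(truncKernel d α r x : ℝ)‖ ≤
      ((p : ℝ) ^ k) ^ (-α) * ((p : ℝ) ^ (-α)) ^ i := by
    intro i
    have hpt : ∀ x ∈ s i, ‖(truncKernel d α r x : ℝ)‖ ≤ ((p : ℝ) ^ (k + i)) ^ (-α - d) := by
      rintro x ⟨-, hx⟩
      rw [Real.norm_of_nonneg (truncKernel_nonneg d α hr x), truncKernel]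
      refine Real.rpow_le_rpow_of_nonpos (zpow_pos hp0 _) ?_ (by linarith [d.cast_nonneg (α := ℝ)])
      by_cases hi : i = 0
      · simpa [hi] using Or.inl hk.le
      · simp only [Set.mem_ofPred_eq, not_and, not_le] at hx
        have hx' := hx hi
        have hx0 : x ≠ 0 := by
          rintro rfl
          rw [norm_zero] at hx'
          exact absurd hx' (zpow_pos hp0 _).not_gt
        obtain ⟨j, hj⟩ := hE.exists_norm_eq x hx0
        rw [hj, zpow_lt_zpow_iff_right₀ hp1] at hx'
        refine le_max_of_le_right ?_
        rw [hj]
        exact zpow_le_zpow_right₀ hp1.le (by omega)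
    have h1 := setIntegral_mono_on (hint i).norm
      (integrableOn_const (hs := ((measure_mono Set.sdiff_subset).trans_lt
        (isCompact_closedBall (0 : E) _).measure_lt_top).ne)) (hmeas i) hpt
    refine h1.trans ?_
    rw [setIntegral_const, smul_eq_mul]
    have h2 : volume.real (s i) ≤ (p : ℝ) ^ ((d : ℤ) * (k + i)) := by
      rw [← hE.volume_closedBall]
      exact measureReal_mono Set.sdiff_subset (isCompact_closedBall (0 : E) _).measure_lt_top.ne
    refine (mul_le_mul_of_nonneg_right h2
      (Real.rpow_nonneg (zpow_pos hp0 _).le _)).trans (le_of_eq ?_)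
    simp only [← Real.rpow_intCast, ← Real.rpow_natCast, ← Real.rpow_mul hp0.le,
      ← Real.rpow_add hp0]
    congr 1
    push_cast
    ring
  refine Summable.of_nonneg_of_le (fun i => integral_nonneg fun _ => norm_nonneg _) hbound ?_
  refine (summable_geometric_of_lt_one (Real.rpow_nonneg hp0.le _) ?_).mul_left _
  exact Real.rpow_lt_one_of_one_lt_of_neg hp1 (by linarith)

end Kernel

/-! ### The hypersingular integral and its single-scale eigenfunctions -/

section Hypersingular

open Metric

variable {p : ℕ} [hp : Fact p.Prime] {E : Type*} [NormedAddCommGroup E] [MeasureSpace E]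
  [BorelSpace E] [ProperSpace E] [(volume : Measure E).IsAddHaarMeasure] [IsUltrametricDist E]

lemma kernel_mul_sub_eq (d : ℕ) (α : ℝ) {r : ℝ} {g : E → ℂ} {x : E}
    (h : ∀ y, ‖y‖ < r → g (x - y) = g x) (y : E) :
    ((‖y‖ ^ (-α - d) : ℝ) : ℂ) * (g (x - y) - g x) =
      ((truncKernel d α r y : ℝ) : ℂ) * (g (x - y) - g x) := by
  rcases lt_or_ge ‖y‖ r with hy | hy
  · rw [h y hy, sub_self, mul_zero, mul_zero]
  · rw [truncKernel_of_le d α hy]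

lemma BallInvariant.sub_eq {r : ℝ} {g : E → ℂ} (h : BallInvariant r g) (x y : E) (hy : ‖y‖ ≤ r) :
    g (x - y) = g x := by
  rw [sub_eq_add_neg, h x (-y) (by rwa [norm_neg])]

lemma integrable_truncKernel_mul {d : ℕ} (hE : IsPadicSpace p d E) {α : ℝ} (hα : 0 < α) {r : ℝ}
    (hr : 0 < r) {g : E → ℂ} (hg : Continuous g) {C : ℝ} (hC : ∀ x, ‖g x‖ ≤ C) :
    Integrable fun y => ((truncKernel d α r y : ℝ) : ℂ) * g y :=
  (integrable_truncKernel hE hα hr).ofReal.mul_bdd (c := C) hg.aestronglyMeasurable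
    (Filter.Eventually.of_forall hC)

lemma integrable_kernel_mul_sub {d : ℕ} (hE : IsPadicSpace p d E) {α : ℝ} (hα : 0 < α)
    {g : E → ℂ} (hg : LocConst p g) {C : ℝ} (hC : ∀ x, ‖g x‖ ≤ C) (x : E) :
    Integrable fun y => ((‖y‖ ^ (-α - d) : ℝ) : ℂ) * (g (x - y) - g x) := by
  obtain ⟨ℓ, hℓ⟩ := id hg
  have hcont := hg.continuous
  simp only [kernel_mul_sub_eq d α (r := (p : ℝ) ^ (-ℓ)) (g := g) (x := x)
    fun y hy => BallInvariant.sub_eq hℓ x y hy.le]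
  refine integrable_truncKernel_mul hE hα (zpow_pos (prime_cast_pos p) _)
    (g := fun y => g (x - y) - g x) (by fun_prop) (C := C + C) fun y => ?_
  exact (norm_sub_le _ _).trans (add_le_add (hC _) (hC _))

variable (p) in
/-- The normalizing constant of the hypersingular integral. -/
def hypConst (d : ℕ) (α : ℝ) : ℂ :=
  (((1 - (p : ℝ) ^ α) / (1 - (p : ℝ) ^ (-α - d)) : ℝ) : ℂ)

variable (p) in
lemma hypConst_ne_zero (d : ℕ) {α : ℝ} (hα : 0 < α) : hypConst p d α ≠ 0 := by
  have hp1 := one_lt_prime_cast p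
  rw [hypConst, Complex.ofReal_ne_zero]
  refine div_ne_zero (sub_ne_zero.mpr (Real.one_lt_rpow hp1 hα).ne) (sub_ne_zero.mpr ?_)
  exact (Real.rpow_lt_one_of_one_lt_of_neg hp1 (by linarith [d.cast_nonneg (α := ℝ)])).ne'

/-- The difference g(x - y) - g(x) vanishes where truncation alters the kernel. With the singularity
gone, the two terms are separately integrable. -/
lemma hypersingular_eq_truncKernel {d : ℕ} (hE : IsPadicSpace p d E) {α : ℝ} (hα : 0 < α)
    {g : E → ℂ} (hg : Continuous g) {C : ℝ} (hC : ∀ x, ‖g x‖ ≤ C) {r : ℝ} (hr : 0 < r) {x : E}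
    (h : ∀ y, ‖y‖ < r → g (x - y) = g x) :
    hypersingular p d α g x = hypConst p d α *
      ((∫ y, ((truncKernel d α r y : ℝ) : ℂ) * g (x - y)) -
        ((∫ y : E, truncKernel d α r y : ℝ) : ℂ) * g x) := by
  rw [hypersingular, hypConst]
  congr 1
  simp only [kernel_mul_sub_eq d α h, mul_sub]
  rw [integral_sub, integral_mul_const, integral_complex_ofReal]
  · exact integrable_truncKernel_mul hE hα hr (g := fun y => g (x - y)) (by fun_prop)
      fun y => hC _
  · exact (integrable_truncKernel hE hα hr).ofReal.mul_const _

/-- Functions oscillating at a single scale are eigenfunctions of the hypersingular integral. -/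
lemma hypersingular_eq_mul {d : ℕ} (hE : IsPadicSpace p d E) {α : ℝ} (hα : 0 < α)
    {g : E → ℂ} {C : ℝ} (hC : ∀ x, ‖g x‖ ≤ C) {N : ℤ}
    (hinv : BallInvariant ((p : ℝ) ^ (-N)) g) (havg : ∀ x, ballAvg ((p : ℝ) ^ (1 - N)) g x = 0)
    (x : E) :
    hypersingular p d α g x =
      -(hypConst p d α * ((∫ y : E, truncKernel d α ((p : ℝ) ^ (1 - N)) y : ℝ) : ℂ)) * g x := by
  have hp0 := prime_cast_pos p
  have hp1 := one_lt_prime_cast p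
  have hr : (0 : ℝ) < (p : ℝ) ^ (1 - N) := zpow_pos hp0 _
  have hcont := hinv.continuous (zpow_pos hp0 _)
  rw [hypersingular_eq_truncKernel hE hα hcont hC hr (x := x)]
  · rw [integral_mul_eq_zero hr (k := fun y => ((truncKernel d α ((p : ℝ) ^ (1 - N)) y : ℝ) : ℂ))
      (g := fun y => g (x - y))]
    · ring
    · intro a b hb
      simp only [truncKernel_add d α a b hb]
    · exact integrable_truncKernel_mul hE hα hr (g := fun y => g (x - y)) (by fun_prop)
        fun y => hC _
    · intro y
      rw [ballAvg_comp_sub_left, havg]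
  · intro y hy
    -- No norm lies strictly between `p^(-N)` and `p^(1-N)`.
    refine hinv.sub_eq x y ?_
    by_cases hy0 : y = 0
    · rw [hy0, norm_zero]; exact (zpow_pos hp0 _).le
    · obtain ⟨k, hk⟩ := hE.exists_norm_eq y hy0
      rw [hk, zpow_lt_zpow_iff_right₀ hp1] at hy
      rw [hk]
      exact zpow_le_zpow_right₀ hp1.le (by omega)

lemma integral_truncKernel_strictAnti {d : ℕ} (hE : IsPadicSpace p d E) {α : ℝ} (hα : 0 < α)
    {r s : ℝ} (hr : 0 < r) (hrs : r < s) :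
    ∫ y : E, truncKernel d α s y < ∫ y : E, truncKernel d α r y := by
  have hs := hr.trans hrs
  have hd : -α - (d : ℝ) < 0 := by linarith [d.cast_nonneg (α := ℝ)]
  have hir := integrable_truncKernel (E := E) hE hα hr
  have his := integrable_truncKernel (E := E) hE hα hs
  rw [← sub_pos, ← integral_sub hir his]
  refine (integral_pos_iff_support_of_nonneg ?_ (hir.sub his)).mpr ?_
  rotate_left
  · refine (measure_closedBall_pos volume (0 : E) hr).trans_le (measure_mono fun y hy => ?_)
    rw [mem_closedBall_zero_iff] at hy
    rw [Function.mem_support, Pi.sub_apply, sub_ne_zero, truncKernel, truncKernel, max_eq_left hy,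
      max_eq_left (hy.trans hrs.le)]
    exact (Real.rpow_lt_rpow_of_neg hr hrs hd).ne'
  · intro y
    refine sub_nonneg.mpr (Real.rpow_le_rpow_of_nonpos (hr.trans_le (le_max_left _ _)) ?_ hd.le)
    exact max_le_max_right _ hrs.le

end Hypersingular

/-! ### Radial eigenfunctions on `ℚ_p` vanishing at the origin -/

section RadialEigenfunction

open Metric

variable {p : ℕ} [hp : Fact p.Prime]

/-- Local constancy at 0 keeps the support away from the origin, and the nonzero norms are powers of
p, so a least one is attained. -/
lemma exists_norm_le_of_ne_zero {W : ℚ_[p] → ℂ} (hloc : LocConst p W) (h0 : W 0 = 0)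
    (hne : ∃ t, W t ≠ 0) : ∃ t₀, W t₀ ≠ 0 ∧ ∀ t, W t ≠ 0 → ‖t₀‖ ≤ ‖t‖ := by
  obtain ⟨ℓ, hℓ⟩ := hloc
  have hp1 := one_lt_prime_cast p
  have hnorm : ∀ t, W t ≠ 0 → ∃ j : ℤ, ‖t‖ = (p : ℝ) ^ j := fun t ht =>
    (isPadicSpace_padic p).exists_norm_eq t fun h => ht (h ▸ h0)
  obtain ⟨j, ⟨t₀, hj, ht₀⟩, hmin⟩ := Int.exists_least_of_bdd
    (P := fun j : ℤ => ∃ t, ‖t‖ = (p : ℝ) ^ j ∧ W t ≠ 0)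
    ⟨-ℓ, fun j ⟨t, hj, ht⟩ => by
      by_contra hlt
      refine ht ?_
      have := hℓ 0 t (by rw [hj]; exact zpow_le_zpow_right₀ hp1.le (by omega))
      rwa [zero_add, h0] at this⟩
    (by
      obtain ⟨t, ht⟩ := hne
      obtain ⟨j, hj⟩ := hnorm t ht
      exact ⟨j, t, hj, ht⟩)
  refine ⟨t₀, ht₀, fun t ht => ?_⟩
  obtain ⟨i, hi⟩ := hnorm t ht
  rw [hi, hj]
  exact zpow_le_zpow_right₀ hp1.le (hmin i ⟨t, hi, ht⟩)

/-- For a real-valued function, the eigenvalue equation of the hypersingular integral, written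
with the eigenvalue read off at the smallest radius where the function does not vanish, is
incompatible with vanishing of the hypersingular integral at the origin. -/
lemma integral_kernel_ne_zero {α : ℝ} (hα : 0 < α) {V : ℚ_[p] → ℝ} {t₀ : ℚ_[p]} (ht₀ : t₀ ≠ 0)
    (hsmall : ∀ t, ‖t‖ < ‖t₀‖ → V t = 0) (hone : ∀ t, ‖t‖ = ‖t₀‖ → V t = 1)
    (hm : ∀ r : ℝ, 0 < r → Integrable fun y => truncKernel 1 α r y * V y)
    (hk : Integrable fun y => ‖y‖ ^ (-α - (1 : ℕ)) * V y)
    (heq : ∀ t, t ≠ 0 → ∫ y, truncKernel 1 α ‖t‖ y * V y =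
      ((∫ y : ℚ_[p], truncKernel 1 α ‖t‖ y) - ∫ y : ℚ_[p], truncKernel 1 α ‖t₀‖ y) * V t) :
    ∫ y, ‖y‖ ^ (-α - (1 : ℕ)) * V y ≠ 0 := by
  have hE := isPadicSpace_padic p
  have hp1 := one_lt_prime_cast p
  have hp0 := prime_cast_pos p
  have hd : -α - ((1 : ℕ) : ℝ) ≤ 0 := by push_cast; linarith
  intro hzero
  obtain ⟨j, hj⟩ := hE.exists_norm_eq t₀ ht₀
  have hr₀ : 0 < ‖t₀‖ := norm_pos_iff.mpr ht₀
  have hnonneg : ∀ m : ℕ, ∀ t, ‖t‖ ≤ (p : ℝ) ^ (j + m) → 0 ≤ V t := by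
    intro m
    induction m with
    | zero =>
      intro t ht
      rw [Nat.cast_zero, add_zero, ← hj] at ht
      rcases ht.lt_or_eq with h | h
      · rw [hsmall t h]
      · rw [hone t h]; exact zero_le_one
    | succ m ih =>
      intro t ht
      by_cases hle : ‖t‖ ≤ (p : ℝ) ^ (j + m)
      · exact ih t hle
      rw [not_le] at hle
      have hlt : ‖t₀‖ < ‖t‖ := by
        refine lt_of_le_of_lt ?_ hle
        rw [hj]
        exact zpow_le_zpow_right₀ hp1.le (by omega)
      have ht0 : t ≠ 0 := norm_pos_iff.mp (hr₀.trans hlt)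
      -- Only radii below ‖t‖ contribute; there V is nonnegative by induction and the full kernel
      -- dominates the truncated one. By `hzero` and `heq` the integral is a positive multiple of
      -- V(t), since the mass of the truncated kernel decreases with the radius.
      have hint : 0 ≤ ∫ y, (‖y‖ ^ (-α - (1 : ℕ)) * V y - truncKernel 1 α ‖t‖ y * V y) := by
        refine integral_nonneg fun y => ?_
        simp only [Pi.zero_apply, ← sub_mul]
        rcases lt_or_ge ‖y‖ ‖t‖ with hy | hy
        · by_cases hy0 : y = 0
          · rw [hy0, hsmall 0 (by rwa [norm_zero]), mul_zero]
          refine mul_nonneg (sub_nonneg.mpr ?_) (ih y ?_)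
          · exact Real.rpow_le_rpow_of_nonpos (norm_pos_iff.mpr hy0) (le_max_right _ _) hd
          · obtain ⟨i, hi⟩ := hE.exists_norm_eq y hy0
            have := hy.trans_le ht
            rw [hi, zpow_lt_zpow_iff_right₀ hp1] at this
            rw [hi]
            exact zpow_le_zpow_right₀ hp1.le (by push_cast at this; omega)
        · rw [truncKernel_of_le 1 α hy, sub_self, zero_mul]
      rw [integral_sub hk (hm _ (norm_pos_iff.mpr ht0)), hzero, heq t ht0] at hint
      have := integral_truncKernel_strictAnti hE hα hr₀ hlt
      nlinarith
  have hpos : ∀ t, 0 ≤ V t := by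
    intro t
    obtain ⟨m, hm'⟩ := exists_le_zpow p (‖t‖ / (p : ℝ) ^ j)
    refine hnonneg m t ?_
    rw [zpow_add₀ hp0.ne', zpow_natCast, mul_comm]
    exact (div_le_iff₀ (zpow_pos hp0 _)).mp hm'
  refine absurd hzero (ne_of_gt ?_)
  rw [integral_pos_iff_support_of_nonneg (fun y => mul_nonneg
    (Real.rpow_nonneg (norm_nonneg _) _) (hpos y)) hk]
  refine (measure_ball_pos volume t₀ hr₀).trans_le (measure_mono fun y hy => ?_)
  have hy' : ‖y‖ = ‖t₀‖ := by
    rw [mem_ball, dist_eq_norm] at hy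
    exact norm_eq_of_norm_sub_lt hy
  rw [Function.mem_support, hone y hy', mul_one, hy']
  exact (Real.rpow_pos_of_pos hr₀ _).ne'

/-- A bounded radial eigenfunction of the hypersingular integral on `ℚ_p` that vanishes at the
origin vanishes identically. -/
theorem eq_zero_of_radial_eigenfunction {α : ℝ} (hα : 0 < α) {W : ℚ_[p] → ℂ} {C : ℝ}
    (hC : ∀ t, ‖W t‖ ≤ C) (hloc : LocConst p W) (hrad : ∀ s t, ‖s‖ = ‖t‖ → W s = W t)
    (h0 : W 0 = 0) (μ : ℂ) (heq : ∀ t, hypersingular p 1 α W t = μ * W t) (t : ℚ_[p]) :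
    W t = 0 := by
  by_contra hne
  have hE := isPadicSpace_padic p
  have hcont := hloc.continuous
  have hc := hypConst_ne_zero p 1 hα
  obtain ⟨t₀, ht₀, hmin⟩ := exists_norm_le_of_ne_zero hloc h0 ⟨t, hne⟩
  have ht₀0 : t₀ ≠ 0 := fun h => ht₀ (h ▸ h0)
  have hzi := integrable_kernel_mul_sub hE hα hloc hC 0
  have hneg : ∀ y, W (0 - y) = W y := fun y => hrad _ _ (by rw [zero_sub, norm_neg])
  simp only [hneg, h0, sub_zero] at hzi
  -- This is the eigenvalue equation at the origin, where W vanishes.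
  have hz : ∫ y, ((‖y‖ ^ (-α - (1 : ℕ)) : ℝ) : ℂ) * W y = 0 := by
    have := heq 0
    rw [h0, mul_zero, hypersingular] at this
    simp only [hneg, h0, sub_zero] at this
    exact (mul_eq_zero.mp this).resolve_left hc
  have hmi : ∀ r : ℝ, 0 < r → Integrable fun y => ((truncKernel 1 α r y : ℝ) : ℂ) * W y :=
    fun r hr => integrable_truncKernel_mul hE hα hr hcont hC
  have key : ∀ t, t ≠ 0 → ∫ y, ((truncKernel 1 α ‖t‖ y : ℝ) : ℂ) * W y =
      (((∫ y : ℚ_[p], truncKernel 1 α ‖t‖ y : ℝ) : ℂ) + μ / hypConst p 1 α) * W t := by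
    intro t ht
    have h := heq t
    rw [hypersingular_eq_truncKernel hE hα hcont hC (norm_pos_iff.mpr ht)] at h
    -- The kernel truncated at ‖t‖ does not see the translation by t.
    · have hshift : ∫ y, ((truncKernel 1 α ‖t‖ y : ℝ) : ℂ) * W (t - y) =
          ∫ y, ((truncKernel 1 α ‖t‖ y : ℝ) : ℂ) * W y := by
        rw [← integral_sub_left_eq_self (fun y => ((truncKernel 1 α ‖t‖ y : ℝ) : ℂ) * W y)
          volume t]
        congr 1
        ext y
        rw [sub_eq_neg_add, truncKernel_add 1 α _ _ le_rfl, truncKernel, truncKernel, norm_neg]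
      rw [hshift] at h
      field_simp
      linear_combination h
    · intro y hy
      exact hrad _ _ (norm_eq_of_norm_sub_lt (by simpa using hy))
  -- At the minimal radius truncation changes nothing on the support of W, so the left side of `key`
  -- is the integral `hz`. The quotient is therefore real, which permits passing to real parts of
  -- W/W(t₀).
  have hμ : μ / hypConst p 1 α = -((∫ y : ℚ_[p], truncKernel 1 α ‖t₀‖ y : ℝ) : ℂ) := by
    have h := key t₀ ht₀0
    have : ∀ y, ((truncKernel 1 α ‖t₀‖ y : ℝ) : ℂ) * W y =
        ((‖y‖ ^ (-α - (1 : ℕ)) : ℝ) : ℂ) * W y := by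
      intro y
      by_cases hy : W y = 0
      · rw [hy, mul_zero, mul_zero]
      · rw [truncKernel_of_le 1 α (hmin y hy)]
    simp only [this, hz] at h
    exact eq_neg_of_add_eq_zero_right ((mul_eq_zero.mp h.symm).resolve_right ht₀)
  have hre : ∀ f : ℚ_[p] → ℝ, ∀ y, ((f y : ℂ) * W y / W t₀).re = f y * (W y / W t₀).re := by
    intro f y
    rw [mul_div_assoc, Complex.re_ofReal_mul]
  have hreint : ∀ f : ℚ_[p] → ℝ, (Integrable fun y => (f y : ℂ) * W y) →
      Integrable (fun y => f y * (W y / W t₀).re) ∧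
      ∫ y, f y * (W y / W t₀).re = ((∫ y, (f y : ℂ) * W y) / W t₀).re := by
    intro f hf
    have hf' := hf.div_const (W t₀)
    simp only [← hre f]
    refine ⟨hf'.re, ?_⟩
    rw [← integral_div]
    exact integral_re hf'
  refine integral_kernel_ne_zero hα (V := fun y => (W y / W t₀).re) ht₀0 ?_ ?_ ?_ ?_ ?_ ?_
  · intro t ht
    have : W t = 0 := by
      by_contra h
      exact absurd (hmin t h) (not_le.mpr ht)
    simp [this]
  · intro t ht
    simp [hrad t t₀ ht, div_self ht₀]
  · exact fun r hr => (hreint _ (hmi r hr)).1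
  · exact (hreint _ hzi).1
  · intro t ht
    rw [(hreint _ (hmi _ (norm_pos_iff.mpr ht))).2, key t ht, hμ, ← sub_eq_add_neg,
      ← Complex.ofReal_sub, mul_div_assoc, Complex.re_ofReal_mul]
  · rw [(hreint _ hzi).2, hz, zero_div, Complex.zero_re]

end RadialEigenfunction

/-! ### Uniqueness for bounded locally constant solutions -/

section PointwiseSolutions

open Metric

variable {p : ℕ} [hp : Fact p.Prime]

/-- A radius of local constancy common to all z allows one truncated kernel for the whole family,
which provides the joint integrability for Fubini. -/
lemma hypersingular_integral {E Z : Type*} [NormedAddCommGroup E] [MeasureSpace E]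
    [BorelSpace E] [ProperSpace E] [(volume : Measure E).IsAddHaarMeasure] [IsUltrametricDist E]
    [NormedAddCommGroup Z] [MeasurableSpace Z] [BorelSpace Z] [ProperSpace Z]
    (ν : Measure Z) [IsFiniteMeasure ν] {d : ℕ} (hE : IsPadicSpace p d E) {α : ℝ} (hα : 0 < α)
    {F : E → Z → ℂ} (hF : Continuous fun q : E × Z => F q.1 q.2) {C : ℝ}
    (hC : ∀ x z, ‖F x z‖ ≤ C) {s : ℝ} (hs : 0 < s)
    (hinv : ∀ z, BallInvariant s fun x => F x z) (x : E) :
    hypersingular p d α (fun x => ∫ z, F x z ∂ν) x =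
      ∫ z, hypersingular p d α (fun x => F x z) x ∂ν := by
  have hFint : ∀ x, Integrable (F x) ν := fun x =>
    Integrable.of_bound (by fun_prop) C (Filter.Eventually.of_forall (hC x))
  have hint : Integrable (Function.uncurry fun y z =>
      ((truncKernel d α s y : ℝ) : ℂ) * (F (x - y) z - F x z)) (volume.prod ν) := by
    have hk : Integrable fun y : E => ((truncKernel d α s y : ℝ) : ℂ) :=
      (integrable_truncKernel hE hα hs).ofReal
    refine (hk.comp_fst ν).mul_bdd (c := C + C)
      (Continuous.aestronglyMeasurable ?_) (Filter.Eventually.of_forall fun q => ?_)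
    · exact (hF.comp (by fun_prop : Continuous fun q : E × Z => (x - q.1, q.2))).sub
        (hF.comp (by fun_prop : Continuous fun q : E × Z => (x, q.2)))
    · exact (norm_sub_le _ _).trans (add_le_add (hC _ _) (hC _ _))
  have hpt : ∀ z y, ((‖y‖ ^ (-α - d) : ℝ) : ℂ) * (F (x - y) z - F x z) =
      ((truncKernel d α s y : ℝ) : ℂ) * (F (x - y) z - F x z) := fun z y =>
    kernel_mul_sub_eq d α (g := fun x => F x z) (fun y hy => (hinv z).sub_eq x y hy.le) y
  simp only [hypersingular]
  rw [integral_const_mul]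
  congr 1
  simp only [hpt, ← integral_sub (hFint _) (hFint _), ← integral_const_mul]
  exact integral_integral_swap hint

variable {n : ℕ} {α β : ℝ}

lemma BallInvariant.fst {E Z : Type*} [NormedAddCommGroup E] [NormedAddCommGroup Z] {u : E → Z → ℂ}
    {s : ℝ} (h : BallInvariant s fun q : E × Z => u q.1 q.2) (z : Z) :
    BallInvariant s fun x => u x z := by
  intro x y hy
  have := h (x, z) (y, 0) (by simp [Prod.norm_def, hy])
  simpa using this

lemma BallInvariant.snd {E Z : Type*} [NormedAddCommGroup E] [NormedAddCommGroup Z] {u : E → Z → ℂ}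
    {s : ℝ} (h : BallInvariant s fun q : E × Z => u q.1 q.2) (x : E) :
    BallInvariant s (u x) := by
  intro z y hy
  have := h (x, z) (0, y) (by simp [Prod.norm_def, hy])
  simpa using this

lemma hypersingular_sub {E : Type*} [NormedAddCommGroup E] [MeasureSpace E]
    [BorelSpace E] [ProperSpace E] [(volume : Measure E).IsAddHaarMeasure] [IsUltrametricDist E]
    {d : ℕ} (hE : IsPadicSpace p d E) (hα : 0 < α) {f g : E → ℂ} (hf : LocConst p f)
    (hg : LocConst p g) {C D : ℝ} (hC : ∀ x, ‖f x‖ ≤ C) (hD : ∀ x, ‖g x‖ ≤ D) (x : E) :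
    hypersingular p d α (fun x => f x - g x) x =
      hypersingular p d α f x - hypersingular p d α g x := by
  simp only [hypersingular]
  rw [← mul_sub, ← integral_sub (integrable_kernel_mul_sub hE hα hf hC x)
    (integrable_kernel_mul_sub hE hα hg hD x)]
  congr 2
  ext y
  ring

namespace IsRadialBoundedSolution

lemma locConst_time {u : ℚ_[p] → (Fin n → ℚ_[p]) → ℂ} (hu : IsRadialBoundedSolution α β u)
    (x : Fin n → ℚ_[p]) : LocConst p fun t => u t x := by
  obtain ⟨ℓ, hℓ⟩ := hu.locConst
  exact ⟨ℓ, BallInvariant.fst hℓ x⟩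

lemma locConst_space {u : ℚ_[p] → (Fin n → ℚ_[p]) → ℂ} (hu : IsRadialBoundedSolution α β u)
    (t : ℚ_[p]) : LocConst p (u t) := by
  obtain ⟨ℓ, hℓ⟩ := hu.locConst
  exact ⟨ℓ, BallInvariant.snd hℓ t⟩

lemma sub (hα : 0 < α) (hβ : 0 < β) {u v : ℚ_[p] → (Fin n → ℚ_[p]) → ℂ}
    (hu : IsRadialBoundedSolution α β u) (hv : IsRadialBoundedSolution α β v) :
    IsRadialBoundedSolution α β fun t x => u t x - v t x where
  bounded := by
    obtain ⟨C, hC⟩ := hu.bounded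
    obtain ⟨D, hD⟩ := hv.bounded
    exact ⟨C + D, fun t x => (norm_sub_le _ _).trans (add_le_add (hC t x) (hD t x))⟩
  locConst := by
    obtain ⟨k, hk⟩ := hu.locConst
    obtain ⟨l, hl⟩ := hv.locConst
    have hp1 := one_lt_prime_cast p
    refine ⟨max k l, BallInvariant.sub (f := fun z : ℚ_[p] × (Fin n → ℚ_[p]) => u z.1 z.2)
      (g := fun z : ℚ_[p] × (Fin n → ℚ_[p]) => v z.1 z.2)
      (BallInvariant.mono (s := (p : ℝ) ^ (-k)) hk ?_)
      (BallInvariant.mono (s := (p : ℝ) ^ (-l)) hl ?_)⟩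
    · exact zpow_le_zpow_right₀ hp1.le (neg_le_neg (le_max_left k l))
    · exact zpow_le_zpow_right₀ hp1.le (neg_le_neg (le_max_right k l))
  radial s t h := by simp only [hu.radial s t h, hv.radial s t h]
  equation t x := by
    obtain ⟨C, hC⟩ := hu.bounded
    obtain ⟨D, hD⟩ := hv.bounded
    rw [hypersingular_sub (isPadicSpace_padic p) hα (hu.locConst_time x) (hv.locConst_time x)
        (fun t => hC t x) (fun t => hD t x),
      hypersingular_sub (isPadicSpace_pi p n) hβ (hu.locConst_space t) (hv.locConst_space t)
        (hC t) (hD t)]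
    linear_combination hu.equation t x - hv.equation t x

/-- A spatial average is an integral of translates u(t, x + z). Both operators pass under this
integral, and the space operator commutes with translations. -/
lemma ballAvg (hα : 0 < α) (hβ : 0 < β) {u : ℚ_[p] → (Fin n → ℚ_[p]) → ℂ}
    (hu : IsRadialBoundedSolution α β u) {r : ℝ} (hr : 0 < r) :
    IsRadialBoundedSolution α β fun t => PadicWave.ballAvg r (u t) where
  bounded := by
    obtain ⟨C, hC⟩ := hu.bounded
    exact ⟨C, fun t x => norm_ballAvg_le hr (hC t) x⟩
  locConst := by
    obtain ⟨k, hk⟩ := hu.locConst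
    refine ⟨k, fun x y hy => ?_⟩
    simp only [ballAvg_eq_add]
    congr 2
    ext z
    have := hk (x.1, x.2 + z) y hy
    simp only [Prod.fst_add, Prod.snd_add] at this ⊢
    rw [← this]
    congr 1
    abel
  radial s t h := by simp only [hu.radial s t h]
  equation t x := by
    obtain ⟨C, hC⟩ := hu.bounded
    obtain ⟨k, hk⟩ := hu.locConst
    have hs : (0 : ℝ) < (p : ℝ) ^ (-k) := zpow_pos (prime_cast_pos p) _
    have hcont : Continuous fun q : ℚ_[p] × (Fin n → ℚ_[p]) => u q.1 q.2 := hu.locConst.continuous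
    have : IsFiniteMeasure (volume.restrict (closedBall (0 : Fin n → ℚ_[p]) r)) :=
      ⟨by simpa using (isCompact_closedBall (0 : Fin n → ℚ_[p]) r).measure_lt_top⟩
    have hconst : ∀ {E : Type} [NormedAddCommGroup E] [MeasureSpace E] (d : ℕ) (γ : ℝ) (c : ℂ)
        (g : E → ℂ) (x : E), hypersingular p d γ (fun y => c * g y) x =
          c * hypersingular p d γ g x := by
      intro E _ _ d γ c g x
      simp only [hypersingular, ← mul_sub, mul_left_comm _ c]
      rw [integral_const_mul, mul_left_comm]
    have h1 := hypersingular_integral (volume.restrict (closedBall (0 : Fin n → ℚ_[p]) r))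
      (isPadicSpace_padic p) hα (F := fun t z => u t (x + z))
      (hcont.comp (by fun_prop : Continuous fun q : ℚ_[p] × (Fin n → ℚ_[p]) => (q.1, x + q.2)))
      (fun t z => hC t _) hs (fun z => BallInvariant.fst hk (x + z)) t
    have h2 := hypersingular_integral (volume.restrict (closedBall (0 : Fin n → ℚ_[p]) r))
      (isPadicSpace_pi p n) hβ (F := fun x z => u t (x + z))
      (hcont.comp (by fun_prop :
        Continuous fun q : (Fin n → ℚ_[p]) × (Fin n → ℚ_[p]) => (t, q.1 + q.2)))
      (fun t z => hC _ _) hs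
      (fun z x y hy => by
        have := BallInvariant.snd hk t (x + z) y hy
        simpa only [add_right_comm] using this) x
    have h3 : ∀ z, hypersingular p n β (fun x => u t (x + z)) x =
        hypersingular p n β (u t) (x + z) := by
      intro z
      simp only [hypersingular, sub_add_eq_add_sub]
    have h4 : PadicWave.ballAvg r (u t) = fun x =>
        ((volume.real (closedBall (0 : Fin n → ℚ_[p]) r) : ℝ) : ℂ)⁻¹ *
          ∫ z in closedBall (0 : Fin n → ℚ_[p]) r, u t (x + z) := funext (ballAvg_eq_add r (u t))
    rw [h4]
    simp only [ballAvg_eq_add, hconst]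
    rw [h1, h2]
    simp only [h3, fun z => sub_eq_zero.mp (hu.equation t (x + z)), sub_self]

lemma eq_zero_of_eigenvalue (hα : 0 < α) {w : ℚ_[p] → (Fin n → ℚ_[p]) → ℂ}
    (hw : IsRadialBoundedSolution α β w) (h0 : ∀ x, w 0 x = 0) (μ : ℂ)
    (hμ : ∀ t x, hypersingular p n β (w t) x = μ * w t x) (t : ℚ_[p]) (x : Fin n → ℚ_[p]) :
    w t x = 0 := by
  obtain ⟨C, hC⟩ := hw.bounded
  refine eq_zero_of_radial_eigenfunction hα (W := fun t => w t x) (fun t => hC t x)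
    (hw.locConst_time x) (fun s t h => congrFun (hw.radial s t h) x) (h0 x) μ (fun t => ?_) t
  rw [sub_eq_zero.mp (hw.equation t x), hμ]

/-- The components of a solution that vanishes at time `0` at all spatial scales vanish. -/
lemma ballAvg_eq_ballAvg (hα : 0 < α) (hβ : 0 < β) {w : ℚ_[p] → (Fin n → ℚ_[p]) → ℂ}
    (hw : IsRadialBoundedSolution α β w) (h0 : ∀ x, w 0 x = 0) (N : ℤ) (t : ℚ_[p])
    (x : Fin n → ℚ_[p]) : PadicWave.ballAvg ((p : ℝ) ^ (-N)) (w t) x =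
      PadicWave.ballAvg ((p : ℝ) ^ (1 - N)) (w t) x := by
  have hp1 := one_lt_prime_cast p
  have hr : (0 : ℝ) < (p : ℝ) ^ (-N) := zpow_pos (prime_cast_pos p) _
  have hq : (0 : ℝ) < (p : ℝ) ^ (1 - N) := zpow_pos (prime_cast_pos p) _
  have hrq : (p : ℝ) ^ (-N) ≤ (p : ℝ) ^ (1 - N) := zpow_le_zpow_right₀ hp1.le (by omega)
  have hG := (hw.ballAvg hα hβ hr).sub hα hβ (hw.ballAvg hα hβ hq)
  obtain ⟨C, hC⟩ := hG.bounded
  have hw0 : w 0 = fun _ => 0 := funext h0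
  refine sub_eq_zero.mp (hG.eq_zero_of_eigenvalue hα (fun x => ?_) _ (fun t x =>
    hypersingular_eq_mul (isPadicSpace_pi p n) hβ (hC t) (N := N) ?_ ?_ x) t x)
  · rw [hw0, ballAvg_const hr, ballAvg_const hq, sub_self]
  · exact (ballInvariant_ballAvg _ _).sub ((ballInvariant_ballAvg _ _).mono hrq)
  · exact ballAvg_sub_ballAvg_eq_zero hr hrq (hw.locConst_space t).continuous

theorem eq_of_eq_zero_time (hα : 0 < α) (hβ : 0 < β) {u v : ℚ_[p] → (Fin n → ℚ_[p]) → ℂ}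
    (hu : IsRadialBoundedSolution α β u) (hv : IsRadialBoundedSolution α β v)
    (h0 : ∀ x, u 0 x = v 0 x) (t : ℚ_[p]) (x : Fin n → ℚ_[p]) : u t x = v t x := by
  have hw := hu.sub hα hβ hv
  have hw0 : ∀ x, u 0 x - v 0 x = 0 := fun x => sub_eq_zero.mpr (h0 x)
  -- The eigenvalue is 0 because the difference is constant in x, as all its scale components
  -- vanish.
  refine sub_eq_zero.mp (hw.eq_zero_of_eigenvalue hα hw0 0 (fun t x => ?_) t x)
  have hconst := (hw.locConst_space t).eq_of_ballAvg_eq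
    fun N x => hw.ballAvg_eq_ballAvg hα hβ hw0 N t x
  simp only [hypersingular, hconst _ x, sub_self, mul_zero, integral_zero, zero_mul]

end IsRadialBoundedSolution

end PointwiseSolutions

/-! ### The additive character -/

section CharacterProperties

variable {p : ℕ} [hp : Fact p.Prime]

lemma fracPart_mul_pow (x : ℚ_[p]) : ∃ a : ℤ, fracPart x * (p : ℚ) ^ fracDigits x = a := by
  refine ⟨(PadicInt.appr ⟨x * (p : ℚ_[p]) ^ fracDigits x, norm_mul_pow_fracDigits_le x⟩
    (fracDigits x) : ℤ), ?_⟩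
  have hpp : (p : ℚ) ≠ 0 := by exact_mod_cast hp.out.ne_zero
  rw [fracPart, div_mul_cancel₀ _ (pow_ne_zero _ hpp)]
  simp

lemma norm_sub_fracPart_le (x : ℚ_[p]) : ‖x - (fracPart x : ℚ_[p])‖ ≤ 1 := by
  have hp0 := prime_cast_pos p
  have hpp : (p : ℚ_[p]) ≠ 0 := by exact_mod_cast hp.out.ne_zero
  obtain ⟨z, hz⟩ : ∃ z : ℤ_[p], z = ⟨x * (p : ℚ_[p]) ^ fracDigits x,
    norm_mul_pow_fracDigits_le x⟩ := ⟨_, rfl⟩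
  have hz' : (z : ℚ_[p]) = x * (p : ℚ_[p]) ^ fracDigits x := by rw [hz]
  have h := PadicInt.appr_spec (fracDigits x) z
  rw [← PadicInt.norm_le_pow_iff_mem_span_pow, PadicInt.norm_def, PadicInt.coe_sub,
    PadicInt.coe_natCast, hz'] at h
  have hf : (fracPart x : ℚ_[p]) =
      (z.appr (fracDigits x) : ℚ_[p]) / (p : ℚ_[p]) ^ fracDigits x := by
    rw [fracPart, ← hz]
    push_cast
    rfl
  have : x - (fracPart x : ℚ_[p]) = (x * (p : ℚ_[p]) ^ fracDigits x - z.appr (fracDigits x)) /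
      (p : ℚ_[p]) ^ fracDigits x := by
    rw [hf]
    field_simp
  rw [this, norm_div, norm_pow, Padic.norm_p, inv_pow, div_inv_eq_mul]
  calc _ ≤ (p : ℝ) ^ (-(fracDigits x : ℤ)) * (p : ℝ) ^ fracDigits x := by gcongr
    _ = 1 := by rw [zpow_neg, zpow_natCast, inv_mul_cancel₀ (pow_pos hp0 _).ne']

/-- The norm bound makes m divisible by `p^K`; in other words `ℤ[1/p] ∩ ℤ_p = ℤ`. -/
lemma exists_int_eq_of_norm_le_one {q : ℚ} {K : ℕ} {m : ℤ} (hq : q * (p : ℚ) ^ K = m)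
    (hn : ‖(q : ℚ_[p])‖ ≤ 1) : ∃ j : ℤ, q = j := by
  have hpp : (p : ℚ) ≠ 0 := by exact_mod_cast hp.out.ne_zero
  have hm : ‖(m : ℚ_[p])‖ ≤ (p : ℝ) ^ (-(K : ℤ)) := by
    have : (m : ℚ_[p]) = (q : ℚ_[p]) * (p : ℚ_[p]) ^ K := by
      have := congrArg (Rat.cast : ℚ → ℚ_[p]) hq
      push_cast at this
      exact this.symm
    rw [this, norm_mul, norm_pow, Padic.norm_p, inv_pow, zpow_neg, zpow_natCast]
    exact mul_le_of_le_one_left (by positivity) hn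
  rw [Padic.norm_int_le_pow_iff_dvd] at hm
  obtain ⟨j, rfl⟩ := hm
  refine ⟨j, mul_right_cancel₀ (pow_ne_zero K hpp) (hq.trans ?_)⟩
  push_cast
  ring

/-- The defect has a power of p as denominator and differs by p-adic integers from (x + y) - x - y =
0. -/
lemma fracPart_add (x y : ℚ_[p]) : ∃ j : ℤ, fracPart (x + y) - fracPart x - fracPart y = j := by
  obtain ⟨a, ha⟩ := fracPart_mul_pow (x + y)
  obtain ⟨b, hb⟩ := fracPart_mul_pow x
  obtain ⟨c, hc⟩ := fracPart_mul_pow y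
  refine exists_int_eq_of_norm_le_one (p := p)
    (K := fracDigits (x + y) + fracDigits x + fracDigits y)
    (m := a * p ^ fracDigits x * p ^ fracDigits y - b * p ^ fracDigits (x + y) * p ^ fracDigits y -
      c * p ^ fracDigits (x + y) * p ^ fracDigits x) ?_ ?_
  · push_cast
    rw [← ha, ← hb, ← hc]
    ring
  · have h1 := norm_sub_fracPart_le (x + y)
    have h2 := norm_sub_fracPart_le x
    have h3 := norm_sub_fracPart_le y
    have : ((fracPart (x + y) - fracPart x - fracPart y : ℚ) : ℚ_[p]) =
        -(x + y - (fracPart (x + y) : ℚ_[p])) +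
          ((x - (fracPart x : ℚ_[p])) + (y - (fracPart y : ℚ_[p]))) := by
      push_cast
      ring
    rw [this]
    refine (IsUltrametricDist.norm_add_le_max _ _).trans (max_le (by rwa [norm_neg]) ?_)
    exact (IsUltrametricDist.norm_add_le_max _ _).trans (max_le h2 h3)

lemma chi_add (x y : ℚ_[p]) : chi (x + y) = chi x * chi y := by
  obtain ⟨j, hj⟩ := fracPart_add x y
  have : fracPart (x + y) = fracPart x + fracPart y + j := by linear_combination hj
  have hexp := Complex.exp_periodic.int_mul j
    (2 * Real.pi * Complex.I * (fracPart x : ℂ) + 2 * Real.pi * Complex.I * (fracPart y : ℂ))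
  rw [chi, this, chi, chi, ← Complex.exp_add, ← hexp]
  congr 1
  push_cast
  ring

lemma chi_eq_one_iff (x : ℚ_[p]) : chi x = 1 ↔ ‖x‖ ≤ 1 := by
  have h := norm_sub_fracPart_le x
  rw [chi, Complex.exp_eq_one_iff]
  constructor
  · rintro ⟨j, hj⟩
    have hq : (fracPart x : ℂ) = j := by
      have : (2 * Real.pi * Complex.I : ℂ) ≠ 0 := Complex.two_pi_I_ne_zero
      refine mul_left_cancel₀ this (hj.trans (mul_comm _ _))
    have hq' : fracPart x = j := by exact_mod_cast hq
    rw [hq', Rat.cast_intCast] at h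
    have := IsUltrametricDist.norm_add_le_max (x - (j : ℚ_[p])) j
    rw [sub_add_cancel] at this
    exact this.trans (max_le h (Padic.norm_int_le_one j))
  · intro hx
    obtain ⟨a, ha⟩ := fracPart_mul_pow x
    obtain ⟨j, hj⟩ := exists_int_eq_of_norm_le_one (p := p) ha (by
      have := IsUltrametricDist.norm_add_le_max (-(x - (fracPart x : ℚ_[p]))) x
      rw [neg_sub, sub_add_cancel, ← neg_sub, norm_neg] at this
      exact this.trans (max_le h hx))
    exact ⟨j, by rw [hj]; push_cast; ring⟩

lemma norm_chi (x : ℚ_[p]) : ‖chi x‖ = 1 := by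
  rw [chi, Complex.norm_exp]
  simp

lemma continuous_chi : Continuous (chi : ℚ_[p] → ℂ) := by
  refine BallInvariant.continuous one_pos fun x y hy => ?_
  rw [chi_add, (chi_eq_one_iff y).mpr hy, mul_one]

end CharacterProperties

/-! ### Fourier analysis and functions of a single frequency -/

section FourierAnalysis

open Metric

variable {p : ℕ} [hp : Fact p.Prime] {E : Type*} [NormedAddCommGroup E]

/-- The properties of the standard pairings on `ℚ_p` and `ℚ_pⁿ` used in Fourier analysis. -/
structure IsPairing (B : E → E → ℚ_[p]) : Prop where
  symm : ∀ x y, B x y = B y x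
  add_right : ∀ x y z, B x (y + z) = B x y + B x z
  norm_le : ∀ x y, ‖B x y‖ ≤ ‖x‖ * ‖y‖
  exists_eq : ∀ x, x ≠ 0 → ∀ c, ∃ y, B x y = c ∧ ‖y‖ ≤ ‖c‖ / ‖x‖
  continuous : Continuous fun q : E × E => B q.1 q.2

lemma isPairing_mul : IsPairing fun ξ x : ℚ_[p] => ξ * x where
  symm := mul_comm
  add_right := mul_add
  norm_le x y := (norm_mul x y).le
  exists_eq x hx c := ⟨c / x, mul_div_cancel₀ c hx, (norm_div c x).le⟩
  continuous := by fun_prop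

lemma isPairing_dotProduct (n : ℕ) : IsPairing fun ξ x : Fin n → ℚ_[p] => ξ ⬝ᵥ x where
  symm := dotProduct_comm
  add_right := dotProduct_add
  norm_le x y := by
    refine IsUltrametricDist.norm_sum_le_of_forall_le_of_nonneg (by positivity) fun i _ => ?_
    rw [norm_mul]
    exact mul_le_mul (norm_le_pi_norm x i) (norm_le_pi_norm y i) (norm_nonneg _) (norm_nonneg _)
  exists_eq x hx c := by
    have hne : Nonempty (Fin n) := by
      by_contra h
      rw [not_nonempty_iff] at h
      exact hx (Subsingleton.elim _ _)
    obtain ⟨i, hi⟩ := exists_norm_apply_eq x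
    have hxi : x i ≠ 0 := fun h0 => hx (by rw [← norm_eq_zero, ← hi, h0, norm_zero])
    refine ⟨Pi.single i (c / x i), ?_, ?_⟩
    · rw [dotProduct_single, mul_div_cancel₀ c hxi]
    · rw [Pi.norm_single, norm_div, hi]
  continuous := by fun_prop

namespace IsPairing

variable {B : E → E → ℚ_[p]}

lemma neg_right (hB : IsPairing B) (x y : E) : B x (-y) = -B x y := by
  have h0 : B x 0 = 0 := by simpa using hB.add_right x 0 0
  have := hB.add_right x y (-y)
  rw [add_neg_cancel, h0] at this
  linear_combination -this

lemma sub_right (hB : IsPairing B) (x y z : E) : B x (y - z) = B x y - B x z := by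
  rw [sub_eq_add_neg, hB.add_right, hB.neg_right, sub_eq_add_neg]

lemma chi_eq_one (hB : IsPairing B) {x y : E} (h : ‖x‖ * ‖y‖ ≤ 1) : chi (B x y) = 1 :=
  (chi_eq_one_iff _).mpr ((hB.norm_le x y).trans h)

variable [MeasureSpace E]

/-- Solving B ξ y = 1/p gives a nontrivial value of the character. The factor p lost in the norm of
y is regained since `‖ξ‖ > p^M` means `‖ξ‖ ≥ p^(M+1)`. -/
lemma exists_chi_ne_one (hB : IsPairing B) {d : ℕ} (hE : IsPadicSpace p d E) {M : ℤ}
    {ξ : E} (hξ : (p : ℝ) ^ M < ‖ξ‖) : ∃ y, ‖y‖ ≤ (p : ℝ) ^ (-M) ∧ chi (B ξ y) ≠ 1 := by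
  have hp0 := prime_cast_pos p
  have hp1 := one_lt_prime_cast p
  have hξ0 : ξ ≠ 0 := norm_pos_iff.mp ((zpow_pos hp0 M).trans hξ)
  obtain ⟨k, hk⟩ := hE.exists_norm_eq ξ hξ0
  rw [hk, zpow_lt_zpow_iff_right₀ hp1] at hξ
  obtain ⟨y, hy, hyn⟩ := hB.exists_eq ξ hξ0 ((p : ℚ_[p])⁻¹)
  refine ⟨y, hyn.trans ?_, ?_⟩
  · rw [norm_inv, Padic.norm_p, inv_inv, hk]
    calc (p : ℝ) / (p : ℝ) ^ k = (p : ℝ) ^ (1 - k) := by rw [zpow_sub₀ hp0.ne', zpow_one]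
      _ ≤ (p : ℝ) ^ (-M) := zpow_le_zpow_right₀ hp1.le (by omega)
  · rw [hy, Ne, chi_eq_one_iff, norm_inv, Padic.norm_p, inv_inv]
    exact not_le.mpr hp1

end IsPairing

variable [MeasureSpace E] [BorelSpace E] [ProperSpace E]
  [(volume : Measure E).IsAddHaarMeasure] [IsUltrametricDist E]
  {B : E → E → ℚ_[p]} {d : ℕ}

lemma integral_eq_zero_of_translate {f : E → ℂ} {c : ℂ} (hc : c ≠ 1) (η : E)
    (h : ∀ x, f (x + η) = c * f x) : ∫ x, f x = 0 := by
  have h1 := integral_add_right_eq_self (μ := volume) f η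
  simp only [h, integral_const_mul] at h1
  by_contra hne
  exact hc (mul_right_cancel₀ hne (h1.trans (one_mul _).symm))

lemma integral_chi_closedBall (hB : IsPairing B) (hE : IsPadicSpace p d E) (M : ℤ) (z : E) :
    ∫ ξ, (closedBall (0 : E) ((p : ℝ) ^ M)).indicator (fun _ => (1 : ℂ)) ξ * chi (B ξ z) =
      (closedBall (0 : E) ((p : ℝ) ^ (-M))).indicator (fun _ => (p : ℂ) ^ ((d : ℤ) * M)) z := by
  have hp0 := prime_cast_pos p
  by_cases hz : ‖z‖ ≤ (p : ℝ) ^ (-M)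
  · rw [Set.indicator_of_mem (by simpa using hz)]
    have : ∀ ξ, (closedBall (0 : E) ((p : ℝ) ^ M)).indicator (fun _ => (1 : ℂ)) ξ * chi (B ξ z) =
        (closedBall (0 : E) ((p : ℝ) ^ M)).indicator (fun _ => (1 : ℂ)) ξ := by
      intro ξ
      by_cases hξ : ξ ∈ closedBall (0 : E) ((p : ℝ) ^ M)
      · rw [hB.chi_eq_one, mul_one]
        rw [mem_closedBall_zero_iff] at hξ
        calc ‖ξ‖ * ‖z‖ ≤ (p : ℝ) ^ M * (p : ℝ) ^ (-M) := by gcongr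
          _ = 1 := by rw [zpow_neg, mul_inv_cancel₀ (zpow_pos hp0 _).ne']
      · rw [Set.indicator_of_notMem hξ, zero_mul]
    simp only [this]
    rw [integral_indicator measurableSet_closedBall, setIntegral_const, hE.volume_closedBall,
      Complex.real_smul, mul_one]
    push_cast
    rfl
  · rw [Set.indicator_of_notMem (by simpa using hz)]
    obtain ⟨η, hη, hne⟩ := hB.exists_chi_ne_one hE (not_le.mp hz)
    rw [neg_neg] at hη
    refine integral_eq_zero_of_translate hne η fun x => ?_
    rw [ballInvariant_indicator_closedBall le_rfl (0 : E) 1 x η hη, hB.symm (x + η), hB.add_right,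
      chi_add, hB.symm x]
    ring

lemma fourier_eq_zero_of_lt (hB : IsPairing B) (hE : IsPadicSpace p d E) {M : ℤ} {ψ : E → ℂ}
    (hψ : BallInvariant ((p : ℝ) ^ (-M)) ψ) {ξ : E} (hξ : (p : ℝ) ^ M < ‖ξ‖) :
    fourier B ψ ξ = 0 := by
  obtain ⟨η, hη, hne⟩ := hB.exists_chi_ne_one hE hξ
  refine integral_eq_zero_of_translate hne η fun x => ?_
  rw [hψ x η hη, hB.add_right, chi_add]
  ring

lemma continuous_chi_pairing (hB : IsPairing B) (ξ : E) : Continuous fun x => chi (B ξ x) :=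
  continuous_chi.comp (hB.continuous.comp (by fun_prop : Continuous fun x : E => (ξ, x)))

lemma fourier_eq_zero_of_le (hB : IsPairing B) {q : ℝ} (hq : 0 < q) {ψ : E → ℂ}
    (hi : Integrable ψ) (hψ : ∀ x, ballAvg q ψ x = 0) {ξ : E} (hξ : ‖ξ‖ * q ≤ 1) :
    fourier B ψ ξ = 0 := by
  refine integral_mul_eq_zero hq (fun x y hy => ?_) ?_ hψ
  · rw [hB.add_right, chi_add, hB.chi_eq_one (y := y), mul_one]
    exact (mul_le_mul_of_nonneg_left hy (norm_nonneg _)).trans hξ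
  · exact hi.bdd_mul (c := 1) (continuous_chi_pairing hB ξ).aestronglyMeasurable
      (Filter.Eventually.of_forall fun x => (norm_chi _).le)

/-- Cutting off the Fourier transform at the radius `p ^ M` amounts to averaging over balls of
radius `p ^ (-M)`. -/
lemma fourierInv_indicator_fourier (hB : IsPairing B) (hE : IsPadicSpace p d E) (M : ℤ)
    {ψ : E → ℂ} (hi : Integrable ψ) (x : E) :
    fourierInv B (fun ξ => (closedBall (0 : E) ((p : ℝ) ^ M)).indicator (fun _ => (1 : ℂ)) ξ *
      fourier B ψ ξ) x = ballAvg ((p : ℝ) ^ (-M)) ψ x := by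
  have hp0 : (p : ℂ) ≠ 0 := by exact_mod_cast hp.out.ne_zero
  have hind : Integrable ((closedBall (0 : E) ((p : ℝ) ^ M)).indicator fun _ => (1 : ℂ)) :=
    (integrable_indicator_iff measurableSet_closedBall).mpr
      (integrableOn_const (isCompact_closedBall 0 _).measure_lt_top.ne)
  have hint : Integrable (Function.uncurry fun ξ y => chi (-(B x ξ)) * chi (B ξ y) *
      ((closedBall (0 : E) ((p : ℝ) ^ M)).indicator (fun _ => (1 : ℂ)) ξ * ψ y))
      (volume.prod volume) := by
    refine (hind.mul_prod hi).bdd_mul (c := 1) (Continuous.aestronglyMeasurable ?_)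
      (Filter.Eventually.of_forall fun q => ?_)
    · refine (continuous_chi.comp ?_).mul (continuous_chi.comp hB.continuous)
      exact (hB.continuous.comp (by fun_prop : Continuous fun q : E × E => (x, q.1))).neg
    · rw [norm_mul, norm_chi, norm_chi, one_mul]
  have hchi : ∀ ξ y, chi (-(B x ξ)) * chi (B ξ y) = chi (B ξ (y - x)) := fun ξ y => by
    rw [← chi_add, hB.sub_right, hB.symm x]
    congr 1
    ring
  calc _ = ∫ ξ, ∫ y, chi (-(B x ξ)) * chi (B ξ y) *
        ((closedBall (0 : E) ((p : ℝ) ^ M)).indicator (fun _ => (1 : ℂ)) ξ * ψ y) := by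
        simp only [fourierInv, fourier, ← integral_const_mul]
        congr 1; ext ξ; congr 1; ext y
        ring
    _ = ∫ y, ∫ ξ, chi (-(B x ξ)) * chi (B ξ y) *
        ((closedBall (0 : E) ((p : ℝ) ^ M)).indicator (fun _ => (1 : ℂ)) ξ * ψ y) :=
        integral_integral_swap hint
    _ = ∫ y, (closedBall (0 : E) ((p : ℝ) ^ (-M))).indicator
          (fun _ => (p : ℂ) ^ ((d : ℤ) * M)) (y - x) * ψ y := by
        congr 1; ext y
        rw [← integral_chi_closedBall hB hE, ← integral_mul_const]
        congr 1; ext ξ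
        rw [hchi]
        ring
    _ = _ := by
        rw [ballAvg_eq_integral_indicator]
        congr 1; ext y
        congr 1
        have hv : ((volume.real (closedBall (0 : E) ((p : ℝ) ^ (-M))) : ℝ) : ℂ)⁻¹ =
            (p : ℂ) ^ ((d : ℤ) * M) := by
          rw [hE.volume_closedBall]
          push_cast
          rw [← zpow_neg]
          congr 1
          ring
        rw [hv]
        simp only [Set.indicator, mem_closedBall, dist_eq_norm, sub_zero]

/-- `ψ` oscillates at the scale `p ^ (-M)`, that is, its Fourier transform is supported on the
sphere of radius `p ^ M`. -/
structure HasFrequency (p : ℕ) (M : ℤ) (ψ : E → ℂ) : Prop where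
  invariant : BallInvariant ((p : ℝ) ^ (-M)) ψ
  ballAvg_eq_zero : ∀ x, ballAvg ((p : ℝ) ^ (1 - M)) ψ x = 0

/-- Invariance kills the Fourier transform above radius `p^M`, and vanishing averages kill it up to
`p^(M-1)`. On the remaining sphere the symbol is constant, and Fourier inversion reduces to the
average that fixes ψ. -/
lemma HasFrequency.fracDiff_eq (hB : IsPairing B) (hE : IsPadicSpace p d E) {M : ℤ} {ψ : E → ℂ}
    (hψ : HasFrequency p M ψ) (hi : Integrable ψ) (α : ℝ) (x : E) :
    fracDiff B α ψ x = ((((p : ℝ) ^ M) ^ α : ℝ) : ℂ) * ψ x := by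
  have hp0 := prime_cast_pos p
  have hp1 := one_lt_prime_cast p
  have hmul : ∀ ξ, ((‖ξ‖ ^ α : ℝ) : ℂ) * fourier B ψ ξ = ((((p : ℝ) ^ M) ^ α : ℝ) : ℂ) *
      ((closedBall (0 : E) ((p : ℝ) ^ M)).indicator (fun _ => (1 : ℂ)) ξ * fourier B ψ ξ) := by
    intro ξ
    rcases lt_or_ge ((p : ℝ) ^ M) ‖ξ‖ with h | h
    · simp [fourier_eq_zero_of_lt hB hE hψ.invariant h]
    rw [Set.indicator_of_mem (by simpa using h), one_mul]
    rcases le_or_gt ‖ξ‖ ((p : ℝ) ^ (M - 1)) with h' | h'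
    · rw [fourier_eq_zero_of_le hB (zpow_pos hp0 (1 - M)) hi hψ.ballAvg_eq_zero, mul_zero, mul_zero]
      calc ‖ξ‖ * (p : ℝ) ^ (1 - M) ≤ (p : ℝ) ^ (M - 1) * (p : ℝ) ^ (1 - M) := by gcongr
        _ = 1 := by rw [← zpow_add₀ hp0.ne']; simp
    · have hξ0 : ξ ≠ 0 := norm_pos_iff.mp ((zpow_pos hp0 _).trans h')
      obtain ⟨k, hk⟩ := hE.exists_norm_eq ξ hξ0
      rw [hk, zpow_lt_zpow_iff_right₀ hp1] at h'
      rw [hk, zpow_le_zpow_iff_right₀ hp1] at h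
      rw [hk, show k = M by omega]
  have h := fourierInv_indicator_fourier hB hE M hi x
  rw [hψ.invariant.ballAvg_eq (zpow_pos hp0 _)] at h
  rw [← h, fracDiff]
  simp only [fourierInv, hmul]
  rw [← integral_const_mul]
  congr 1
  ext ξ
  ring

end FourierAnalysis

/-! ### Decomposition of the Lizorkin space into scales -/

section Scales

open Metric

variable {p : ℕ} [hp : Fact p.Prime] {E : Type*} [NormedAddCommGroup E] [MeasureSpace E]
  [BorelSpace E] [ProperSpace E] [(volume : Measure E).IsAddHaarMeasure] [IsUltrametricDist E]

lemma exists_eq_zero_of_lt_norm {φ : E → ℂ} (h : HasCompactSupport φ) :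
    ∃ R : ℝ, ∀ x, R < ‖x‖ → φ x = 0 := by
  obtain ⟨R, hR⟩ := h.isCompact.isBounded.subset_closedBall (0 : E)
  refine ⟨R, fun x hx => ?_⟩
  by_contra hne
  have := hR (subset_tsupport φ hne)
  rw [mem_closedBall_zero_iff] at this
  exact absurd hx (not_lt.mpr this)

lemma hasCompactSupport_of_eq_zero {φ : E → ℂ} {R : ℝ} (h : ∀ x, R < ‖x‖ → φ x = 0) :
    HasCompactSupport φ :=
  HasCompactSupport.of_support_subset_isCompact (isCompact_closedBall 0 R) fun x hx => by
    rw [mem_closedBall_zero_iff]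
    exact not_lt.mp fun hlt => hx (h x hlt)

lemma ballAvg_eq_zero_of_lt_norm {φ : E → ℂ} {R r : ℝ} (h : ∀ x, R < ‖x‖ → φ x = 0) {x : E}
    (hx : max R r < ‖x‖) : ballAvg r φ x = 0 := by
  rw [ballAvg_congr (g := fun _ => 0) fun y hy => h y (lt_of_not_ge fun hyR => ?_)]
  · simp [ballAvg]
  · have := IsUltrametricDist.norm_add_le_max y (x - y)
    rw [add_sub_cancel, norm_sub_rev] at this
    exact absurd hx (not_lt.mpr (this.trans (max_le_max hyR hy)))

lemma locConst_of_ballInvariant {k : ℤ} {g : E → ℂ} (h : BallInvariant ((p : ℝ) ^ k) g) :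
    LocConst p g := ⟨-k, by rwa [neg_neg]⟩

lemma ballAvg_mem_lizorkin {φ : E → ℂ} (hφ : φ ∈ lizorkin p E) (k : ℤ) :
    ballAvg ((p : ℝ) ^ k) φ ∈ lizorkin p E := by
  obtain ⟨R, hR⟩ := exists_eq_zero_of_lt_norm hφ.1.2
  refine ⟨⟨locConst_of_ballInvariant (ballInvariant_ballAvg _ φ),
    hasCompactSupport_of_eq_zero fun x hx => ballAvg_eq_zero_of_lt_norm hR hx⟩, ?_⟩
  have := integral_mul_ballAvg (zpow_pos (prime_cast_pos p) k) (k := fun _ : E => 1)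
    (g := φ) (fun _ _ _ => rfl) (by simpa using integrable_of_mem_testSpace hφ.1)
  simpa [hφ.2] using this

/-- The component of `φ` of frequency `p ^ M`. -/
def scaleProj (M : ℤ) (φ : lizorkin p E) : lizorkin p E :=
  ⟨ballAvg ((p : ℝ) ^ (-M)) φ, ballAvg_mem_lizorkin φ.2 _⟩ -
    ⟨ballAvg ((p : ℝ) ^ (1 - M)) φ, ballAvg_mem_lizorkin φ.2 _⟩

variable (p) in
lemma zpow_neg_le_zpow_one_sub (M : ℤ) : (p : ℝ) ^ (-M) ≤ (p : ℝ) ^ (1 - M) :=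
  zpow_le_zpow_right₀ (one_lt_prime_cast p).le (by omega)

lemma hasFrequency_scaleProj (M : ℤ) (φ : lizorkin p E) :
    HasFrequency p M (scaleProj M φ : E → ℂ) where
  invariant := (ballInvariant_ballAvg _ _).sub
    ((ballInvariant_ballAvg _ _).mono (zpow_neg_le_zpow_one_sub p M))
  ballAvg_eq_zero := ballAvg_sub_ballAvg_eq_zero (zpow_pos (prime_cast_pos p) _)
    (zpow_neg_le_zpow_one_sub p M) φ.2.1.1.continuous

lemma ballAvg_eq_zero_of_integral_eq_zero {φ : E → ℂ} (hint : ∫ x, φ x = 0) {r : ℝ}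
    (h : ∀ x, r < ‖x‖ → φ x = 0) (x : E) : ballAvg r φ x = 0 := by
  rcases le_or_gt ‖x‖ r with hx | hx
  · have hball : closedBall 0 r = closedBall x r :=
      IsUltrametricDist.closedBall_eq_of_mem (by simpa using hx)
    rw [ballAvg, ← hball,
      setIntegral_eq_integral_of_forall_compl_eq_zero, hint, mul_zero]
    intro y hy
    exact h y (by simpa using hy)
  · exact ballAvg_eq_zero_of_lt_norm h (by simpa using hx)

/-- An element of the Lizorkin space is the sum of its finitely many non-zero components. -/
lemma exists_sum_scaleProj (φ : lizorkin p E) :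
    ∃ S : Finset ℤ, φ = ∑ M ∈ S, scaleProj M φ ∧ ∀ M, M ∉ S → scaleProj M φ = 0 := by
  have hp1 := one_lt_prime_cast p
  obtain ⟨R, hR⟩ := exists_eq_zero_of_lt_norm φ.2.1.2
  obtain ⟨ℓ, hℓ⟩ := φ.2.1.1
  obtain ⟨m, hm⟩ := exists_le_zpow p R
  let A : ℤ → lizorkin p E := fun M =>
    ⟨ballAvg ((p : ℝ) ^ (-M)) φ, ballAvg_mem_lizorkin φ.2 _⟩
  have hproj : ∀ M, scaleProj M φ = A M - A (M - 1) := by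
    intro M
    simp only [scaleProj, A, neg_sub]
  have hhigh : ∀ M, ℓ ≤ M → A M = φ := fun M hM => Subtype.ext
    (BallInvariant.ballAvg_eq (zpow_pos (prime_cast_pos p) _)
      (BallInvariant.mono (s := (p : ℝ) ^ (-ℓ)) hℓ (zpow_le_zpow_right₀ hp1.le (by omega))))
  -- The mean-zero condition enters here: a ball containing the support has average 0.
  have hlow : ∀ M : ℤ, M ≤ -m → A M = 0 := fun M hM => Subtype.ext (funext fun x => by
    refine ballAvg_eq_zero_of_integral_eq_zero φ.2.2 (fun y hy => hR y (hm.trans_lt ?_)) x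
    refine lt_of_le_of_lt ?_ hy
    rw [← zpow_natCast]
    exact zpow_le_zpow_right₀ hp1.le (by omega))
  have htel : ∀ (a : ℤ) (i : ℕ), ∑ M ∈ Finset.Ioc a (a + i), scaleProj M φ = A (a + i) - A a := by
    intro a i
    induction i with
    | zero => simp
    | succ i ih =>
      have : Finset.Ioc a (a + (i + 1 : ℕ)) = insert (a + (i + 1 : ℕ)) (Finset.Ioc a (a + i)) := by
        ext z
        simp only [Finset.mem_Ioc, Finset.mem_insert]
        omega
      rw [this, Finset.sum_insert (by simp), ih, hproj,
        show a + ((i + 1 : ℕ) : ℤ) - 1 = a + i by push_cast; ring]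
      abel
  refine ⟨Finset.Ioc (-m) (-m + ((ℓ + m).toNat : ℕ)), ?_, fun M hM => ?_⟩
  · rw [htel, hlow _ le_rfl, hhigh _ (by omega), sub_zero]
  · rw [Finset.mem_Ioc] at hM
    rw [hproj]
    by_cases h : M ≤ -m
    · rw [hlow M h, hlow (M - 1) (by omega), sub_zero]
    · rw [hhigh M (by omega), hhigh (M - 1) (by omega), sub_self]

/-- The kernel of the projection to frequency `p ^ M` at the point `s`. -/
def scaleKernelFun (p : ℕ) (M : ℤ) (s : E) (y : E) : ℂ :=
  (closedBall s ((p : ℝ) ^ (-M))).indicator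
      (fun _ => ((volume.real (closedBall (0 : E) ((p : ℝ) ^ (-M))) : ℝ) : ℂ)⁻¹) y -
    (closedBall s ((p : ℝ) ^ (1 - M))).indicator
      (fun _ => ((volume.real (closedBall (0 : E) ((p : ℝ) ^ (1 - M))) : ℝ) : ℂ)⁻¹) y

lemma integral_scaleKernelFun_mul (M : ℤ) (s : E) {g : E → ℂ} (hg : Continuous g) :
    ∫ y, scaleKernelFun p M s y * g y =
      ballAvg ((p : ℝ) ^ (-M)) g s - ballAvg ((p : ℝ) ^ (1 - M)) g s := by
  simp only [scaleKernelFun, sub_mul]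
  rw [integral_sub (integrable_indicator_closedBall_mul _ _ hg s)
    (integrable_indicator_closedBall_mul _ _ hg s), ← ballAvg_eq_integral_indicator,
    ← ballAvg_eq_integral_indicator]

lemma ballInvariant_scaleKernelFun (M : ℤ) (s : E) :
    BallInvariant ((p : ℝ) ^ (-M)) (scaleKernelFun p M s) :=
  (ballInvariant_indicator_closedBall le_rfl s _).sub
    (ballInvariant_indicator_closedBall (zpow_neg_le_zpow_one_sub p M) s _)

/-- The average of the kernel is its pairing with the normalized indicator of a ball of radius
`p^(1-M)`, and both averages in the projection fix that indicator. -/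
lemma hasFrequency_scaleKernelFun (M : ℤ) (s : E) :
    HasFrequency p M (scaleKernelFun p M s) where
  invariant := ballInvariant_scaleKernelFun M s
  ballAvg_eq_zero x := by
    have hq : (0 : ℝ) < (p : ℝ) ^ (1 - M) := zpow_pos (prime_cast_pos p) _
    have hr : (0 : ℝ) < (p : ℝ) ^ (-M) := zpow_pos (prime_cast_pos p) _
    have hinv := ballInvariant_indicator_closedBall (le_refl ((p : ℝ) ^ (1 - M))) x
      ((volume.real (closedBall (0 : E) ((p : ℝ) ^ (1 - M))) : ℝ) : ℂ)⁻¹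
    rw [ballAvg_eq_integral_indicator]
    simp only [mul_comm _ (scaleKernelFun p M s _)]
    rw [integral_scaleKernelFun_mul M s (hinv.continuous hq), hinv.ballAvg_eq hq,
      (hinv.mono (zpow_neg_le_zpow_one_sub p M)).ballAvg_eq hr, sub_self]

variable (p) in
/-- `scaleKernelFun` as an element of the Lizorkin space. -/
def scaleKernel (M : ℤ) (s : E) : lizorkin p E := by
  refine ⟨scaleKernelFun p M s, ⟨locConst_of_ballInvariant (ballInvariant_scaleKernelFun M s),
    HasCompactSupport.of_support_subset_isCompact
      (isCompact_closedBall s ((p : ℝ) ^ (1 - M))) fun y hy => ?_⟩, ?_⟩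
  · by_contra h
    refine hy ?_
    rw [scaleKernelFun, Set.indicator_of_notMem h, Set.indicator_of_notMem
      fun h' => h (closedBall_subset_closedBall (zpow_neg_le_zpow_one_sub p M) h'), sub_zero]
  · have := integral_scaleKernelFun_mul (p := p) M s (g := fun _ => 1) continuous_const
    rw [ballAvg_const (zpow_pos (prime_cast_pos p) _),
      ballAvg_const (zpow_pos (prime_cast_pos p) _), sub_self] at this
    simpa using this

lemma integral_scaleKernel_mul (M : ℤ) (s : E) (φ : lizorkin p E) :
    ∫ y, (scaleKernel p M s : E → ℂ) y * (φ : E → ℂ) y = (scaleProj M φ : E → ℂ) s :=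
  integral_scaleKernelFun_mul M s φ.2.1.1.continuous

lemma HasFrequency.add {M : ℤ} {f g : E → ℂ} (hf : HasFrequency p M f) (hg : HasFrequency p M g) :
    HasFrequency p M (f + g) where
  invariant x y hy := by
    rw [Pi.add_apply, Pi.add_apply, hf.invariant x y hy, hg.invariant x y hy]
  ballAvg_eq_zero x := by
    have hr : (0 : ℝ) < (p : ℝ) ^ (-M) := zpow_pos (prime_cast_pos p) _
    have hi : ∀ g : E → ℂ, BallInvariant ((p : ℝ) ^ (-M)) g →
        IntegrableOn g (closedBall x ((p : ℝ) ^ (1 - M))) := fun g hg =>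
      (hg.continuous hr).continuousOn.integrableOn_compact (isCompact_closedBall x _)
    have h1 := hf.ballAvg_eq_zero x
    have h2 := hg.ballAvg_eq_zero x
    simp only [ballAvg, Pi.add_apply] at h1 h2 ⊢
    rw [integral_add (hi f hf.invariant) (hi g hg.invariant), mul_add, h1, h2, add_zero]

lemma HasFrequency.smul {M : ℤ} {f : E → ℂ} (hf : HasFrequency p M f) (c : ℂ) :
    HasFrequency p M (c • f) where
  invariant x y hy := by rw [Pi.smul_apply, Pi.smul_apply, hf.invariant x y hy]
  ballAvg_eq_zero x := by
    have h1 := hf.ballAvg_eq_zero x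
    simp only [ballAvg, Pi.smul_apply, smul_eq_mul] at h1 ⊢
    rw [integral_const_mul, mul_left_comm, h1, mul_zero]

lemma HasFrequency.sum {M : ℤ} {ι : Type*} (s : Finset ι) {f : ι → E → ℂ}
    (hf : ∀ i ∈ s, HasFrequency p M (f i)) : HasFrequency p M (∑ i ∈ s, f i) := by
  classical
  induction s using Finset.induction_on with
  | empty =>
    rw [Finset.sum_empty]
    exact ⟨fun _ _ _ => rfl, fun x => by simp [ballAvg]⟩
  | insert a s ha ih =>
    rw [Finset.sum_insert ha]
    exact (hf a (Finset.mem_insert_self a s)).add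
      (ih fun i hi => hf i (Finset.mem_insert_of_mem hi))

end Scales

/-! ### Dilations by units and radial functions -/

section UnitDilations

open Metric

variable {p : ℕ} [hp : Fact p.Prime]

lemma preimage_mul_closedBall {ε : ℚ_[p]} (hε : ‖ε‖ = 1) (x : ℚ_[p]) (r : ℝ) :
    (fun t => ε * t) ⁻¹' closedBall (ε * x) r = closedBall x r := by
  ext t
  simp [dist_eq_norm, ← mul_sub, hε]

lemma measurePreserving_unit_mul {ε : ℚ_[p]} (hε : ‖ε‖ = 1) :
    MeasurePreserving (fun t : ℚ_[p] => ε * t) := by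
  have hε0 : ε ≠ 0 := norm_pos_iff.mp (by rw [hε]; exact one_pos)
  have hmeas : Measurable fun t : ℚ_[p] => ε * t := (continuous_const_mul ε).measurable
  refine ⟨hmeas, ?_⟩
  have : (Measure.map (fun t : ℚ_[p] => ε * t) volume).IsAddHaarMeasure :=
    Measure.isAddHaarMeasure_map volume (AddMonoidHom.mulLeft ε) (continuous_const_mul ε)
      (Homeomorph.mulLeft₀ ε hε0).surjective
      (Homeomorph.mulLeft₀ ε hε0).isClosedEmbedding.tendsto_cocompact
  rw [Measure.addHaarMeasure_unique (Measure.map (fun t : ℚ_[p] => ε * t) volume) (unitBall p)]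
  have hball : Measure.map (fun t : ℚ_[p] => ε * t) volume (unitBall p) = 1 := by
    have h0 : (unitBall p : Set ℚ_[p]) = closedBall (ε * 0) 1 := by rw [mul_zero]; rfl
    rw [h0, Measure.map_apply hmeas measurableSet_closedBall, preimage_mul_closedBall hε]
    exact Measure.addHaarMeasure_self (K₀ := unitBall p)
  rw [hball, one_smul]
  rfl

lemma measurableEmbedding_mul {ε : ℚ_[p]} (hε : ‖ε‖ = 1) :
    MeasurableEmbedding (fun t : ℚ_[p] => ε * t) :=
  (Homeomorph.mulLeft₀ ε (norm_pos_iff.mp (by rw [hε]; exact one_pos))).measurableEmbedding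

lemma ballAvg_comp_mul {ε : ℚ_[p]} (hε : ‖ε‖ = 1) (r : ℝ) (g : ℚ_[p] → ℂ) (x : ℚ_[p]) :
    ballAvg r (fun t => g (ε * t)) x = ballAvg r g (ε * x) := by
  have h := (measurePreserving_unit_mul hε).setIntegral_preimage_emb
    (measurableEmbedding_mul hε) g (closedBall (ε * x) r)
  rw [ballAvg, ballAvg, ← h, preimage_mul_closedBall hε]

lemma HasFrequency.comp_mul {ε : ℚ_[p]} (hε : ‖ε‖ = 1) {M : ℤ} {g : ℚ_[p] → ℂ}
    (hg : HasFrequency p M g) : HasFrequency p M fun t => g (ε * t) where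
  invariant x y hy := by
    simp only [mul_add]
    exact hg.invariant _ _ (by rwa [norm_mul, hε, one_mul])
  ballAvg_eq_zero x := by rw [ballAvg_comp_mul hε, hg.ballAvg_eq_zero]

/-- The dilation of an element of `Φ(ℚ_p)` by an element of norm `1`. -/
def dilate (ε : ℚ_[p]) (hε : ‖ε‖ = 1) (φ : PhiTime p) : PhiTime p := by
  refine ⟨fun t => (φ : ℚ_[p] → ℂ) (ε * t), ⟨?_, ?_⟩, ?_⟩
  · obtain ⟨ℓ, hℓ⟩ := φ.2.1.1
    refine ⟨ℓ, fun x y hy => ?_⟩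
    simp only [mul_add]
    exact hℓ _ _ (by rwa [norm_mul, hε, one_mul])
  · obtain ⟨R, hR⟩ := exists_eq_zero_of_lt_norm φ.2.1.2
    exact hasCompactSupport_of_eq_zero fun x hx => hR _ (by rwa [norm_mul, hε, one_mul])
  · rw [(measurePreserving_unit_mul hε).integral_comp (measurableEmbedding_mul hε)]
    exact φ.2.2

/-- A radial function of a single frequency is determined by its value at the origin. -/
lemma HasFrequency.eq_zero_of_radial {M : ℤ} {g : ℚ_[p] → ℂ} (hg : HasFrequency p M g)
    (hrad : ∀ s t, ‖s‖ = ‖t‖ → g s = g t) (h0 : g 0 = 0) (t : ℚ_[p]) : g t = 0 := by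
  have hp0 := prime_cast_pos p
  have hp1 := one_lt_prime_cast p
  have hq : (0 : ℝ) < (p : ℝ) ^ (1 - M) := zpow_pos hp0 _
  have hin : ∀ t, ‖t‖ ≤ (p : ℝ) ^ (-M) → g t = 0 := fun t ht => by
    rw [← h0]
    exact hg.invariant.eq_of_norm_sub_le (by simpa using ht)
  have havg := hg.ballAvg_eq_zero
  -- Far out, the ball around t lies in one sphere, so the vanishing average equals g(t).
  rcases lt_or_ge ((p : ℝ) ^ (1 - M)) ‖t‖ with ht | ht
  · have h := havg t
    rwa [ballAvg_congr (g := fun _ => g t) fun y hy => hrad _ _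
      (norm_eq_of_norm_sub_lt (hy.trans_lt ht)), ballAvg_const hq] at h
  by_cases ht' : ‖t‖ ≤ (p : ℝ) ^ (-M)
  · exact hin t ht'
  have hnorm : ∀ y : ℚ_[p], ‖y‖ ≤ (p : ℝ) ^ (1 - M) → ¬ ‖y‖ ≤ (p : ℝ) ^ (-M) →
      ‖y‖ = (p : ℝ) ^ (1 - M) := by
    intro y hy hy'
    have hy0 : y ≠ 0 := by
      rintro rfl
      exact hy' (by rw [norm_zero]; exact (zpow_pos hp0 _).le)
    obtain ⟨k, hk⟩ := (isPadicSpace_padic p).exists_norm_eq y hy0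
    rw [hk, zpow_le_zpow_iff_right₀ hp1] at hy hy'
    rw [hk, show k = 1 - M by omega]
  -- The central ball consists of a smaller ball, where g = 0, and a single sphere of positive
  -- volume, where g = g(t).
  have h := havg 0
  rw [ballAvg_congr (g := fun y => g t -
    (closedBall (0 : ℚ_[p]) ((p : ℝ) ^ (-M))).indicator (fun _ => g t) y)] at h
  · rw [ballAvg, mul_eq_zero] at h
    have h := h.resolve_left (inv_ne_zero (by
      exact_mod_cast (volume_closedBall_pos (E := ℚ_[p]) hq).ne'))
    have hc : ∀ r : ℝ, IntegrableOn (fun _ : ℚ_[p] => g t) (closedBall 0 r) := fun r =>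
      integrableOn_const (isCompact_closedBall _ _).measure_lt_top.ne
    rw [integral_sub (hc _)
      ((integrable_indicator_iff measurableSet_closedBall).mpr (hc _)).integrableOn,
      setIntegral_indicator measurableSet_closedBall, Set.inter_eq_self_of_subset_right
        (closedBall_subset_closedBall (zpow_neg_le_zpow_one_sub p M)), setIntegral_const,
      setIntegral_const, volume_closedBall_padic, volume_closedBall_padic, ← sub_smul,
      smul_eq_zero] at h
    refine h.resolve_left (sub_ne_zero.mpr (zpow_right_injective₀ hp0 hp1.ne' |>.ne ?_))
    omega
  · intro y hy
    rw [sub_zero] at hy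
    by_cases hy' : ‖y‖ ≤ (p : ℝ) ^ (-M)
    · rw [hin y hy', Set.indicator_of_mem (by simpa using hy'), sub_self]
    · rw [Set.indicator_of_notMem (by simpa using hy'), sub_zero]
      exact hrad _ _ ((hnorm y hy hy').trans (hnorm t ht ht').symm)

/-- Averaging over the finite group of units modulo a power of `p` makes a test function
radial. -/
lemma exists_radial_sum_dilate (φ : PhiTime p) : ∃ (ι : Type) (_ : Fintype ι) (_ : Nonempty ι)
    (ε : ι → ℚ_[p]), (∀ i, ‖ε i‖ = 1) ∧ ∀ s t : ℚ_[p], ‖s‖ = ‖t‖ →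
      ∑ i, (φ : ℚ_[p] → ℂ) (ε i * s) = ∑ i, (φ : ℚ_[p] → ℂ) (ε i * t) := by
  have hp0 := prime_cast_pos p
  obtain ⟨R, hR⟩ := exists_eq_zero_of_lt_norm φ.2.1.2
  obtain ⟨ℓ, hℓ⟩ := φ.2.1.1
  -- With this m, units congruent mod `p^m` move points of norm at most R to within `p^(-ℓ)` of each
  -- other, where φ cannot distinguish them.
  obtain ⟨m, hm⟩ := exists_le_zpow p (R * (p : ℝ) ^ ℓ)
  let ρ := (Units.map (PadicInt.toZModPow (p := p) m).toMonoidHom).rangeRestrict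
  have hρ : Function.Surjective ρ := MonoidHom.rangeRestrict_surjective _
  have : NeZero (p ^ m) := ⟨pow_ne_zero m hp.out.ne_zero⟩
  have hcongr : ∀ x y : ℤ_[p]ˣ, ρ x = ρ y → ∀ t : ℚ_[p],
      (φ : ℚ_[p] → ℂ) (((x : ℤ_[p]) : ℚ_[p]) * t) =
        (φ : ℚ_[p] → ℂ) (((y : ℤ_[p]) : ℚ_[p]) * t) := by
    intro x y hxy t
    have hx1 : ‖((x : ℤ_[p]) : ℚ_[p])‖ = 1 := PadicInt.norm_units x
    have hy1 : ‖((y : ℤ_[p]) : ℚ_[p])‖ = 1 := PadicInt.norm_units y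
    rcases lt_or_ge R ‖t‖ with ht | ht
    · rw [hR _ (by rwa [norm_mul, hx1, one_mul]), hR _ (by rwa [norm_mul, hy1, one_mul])]
    · refine BallInvariant.eq_of_norm_sub_le (r := (p : ℝ) ^ (-ℓ)) hℓ ?_
      have hz : PadicInt.toZModPow m (x : ℤ_[p]) = PadicInt.toZModPow m (y : ℤ_[p]) :=
        congrArg (Units.val) (congrArg Subtype.val hxy)
      have hmem : (x : ℤ_[p]) - y ∈ RingHom.ker (PadicInt.toZModPow (p := p) m) := by
        rw [RingHom.mem_ker, map_sub, hz, sub_self]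
      rw [PadicInt.ker_toZModPow, ← PadicInt.norm_le_pow_iff_mem_span_pow, PadicInt.norm_def,
        PadicInt.coe_sub] at hmem
      rw [← sub_mul, norm_mul]
      calc _ ≤ (p : ℝ) ^ (-(m : ℤ)) * R :=
            mul_le_mul hmem ht (norm_nonneg _) (zpow_pos hp0 _).le
        _ ≤ (p : ℝ) ^ (-ℓ) := by
            rw [zpow_neg, zpow_neg, zpow_natCast, inv_mul_le_iff₀ (pow_pos hp0 m),
              ← div_eq_mul_inv, le_div_iff₀ (zpow_pos hp0 _)]
            exact hm
  let _ : Fintype (Units.map (PadicInt.toZModPow (p := p) m).toMonoidHom).range :=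
    Fintype.ofFinite _
  let L := Function.surjInv hρ
  have hL : ∀ a, ρ (L a) = a := Function.surjInv_eq hρ
  refine ⟨(Units.map (PadicInt.toZModPow (p := p) m).toMonoidHom).range,
    inferInstance, ⟨1⟩, fun a => ((L a : ℤ_[p]) : ℚ_[p]), fun a => PadicInt.norm_units _,
    fun s t hst => ?_⟩
  by_cases ht : t = 0
  · rw [ht, norm_zero, norm_eq_zero] at hst
    rw [hst, ht]
  have hε : ‖s / t‖ = 1 := by rw [norm_div, hst, div_self (norm_ne_zero_iff.mpr ht)]
  let ε := PadicInt.mkUnits hε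
  have hεc : ((ε : ℤ_[p]) : ℚ_[p]) = s / t := PadicInt.mkUnits_eq hε
  -- Replacing t by s = εt permutes the unit classes by multiplication.
  refine Fintype.sum_equiv (Equiv.mulRight (ρ ε)) _ _ fun a => ?_
  have := hcongr (L a * ε) (L (a * ρ ε)) (by rw [map_mul, hL, hL]) t
  rw [Equiv.coe_mulRight, ← this, Units.val_mul, PadicInt.coe_mul, hεc, mul_assoc,
    div_mul_cancel₀ s ht]

end UnitDilations

/-! ### Radial generalized solutions and their representing functions -/

section GeneralizedSolutions

open Metric

variable {p : ℕ} [hp : Fact p.Prime] {n : ℕ} {α β : ℝ}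

lemma zpow_rpow_injective (hα : 0 < α) :
    Function.Injective fun M : ℤ => ((p : ℝ) ^ M) ^ α := by
  have hp0 := prime_cast_pos p
  intro M N h
  exact zpow_right_injective₀ hp0 (one_lt_prime_cast p).ne'
    (Real.rpow_left_injOn hα.ne' (zpow_pos hp0 M).le (zpow_pos hp0 N).le h)

/-- A generalized solution only pairs components of matching temporal and spatial frequency. -/
lemma IsGeneralizedSolution.eq_zero_of_ne {u : VectorDist p n} (hu : IsGeneralizedSolution α β u)
    {M N : ℤ} {φ₁ : PhiTime p} {φ₂ : PhiSpace p n} (h₁ : HasFrequency p M (φ₁ : ℚ_[p] → ℂ))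
    (h₂ : HasFrequency p N (φ₂ : (Fin n → ℚ_[p]) → ℂ))
    (hne : ((p : ℝ) ^ M) ^ α ≠ ((p : ℝ) ^ N) ^ β) : u φ₁ φ₂ = 0 := by
  have h := hu φ₁ (((((p : ℝ) ^ M) ^ α : ℝ) : ℂ) • φ₁) φ₂ (((((p : ℝ) ^ N) ^ β : ℝ) : ℂ) • φ₂)
    (funext fun t => (h₁.fracDiff_eq isPairing_mul (isPadicSpace_padic p)
      (integrable_of_mem_testSpace φ₁.2.1) α t).symm)
    (funext fun x => (h₂.fracDiff_eq (isPairing_dotProduct n) (isPadicSpace_pi p n)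
      (integrable_of_mem_testSpace φ₂.2.1) β x).symm)
  rw [map_smul, map_smul, LinearMap.smul_apply, smul_eq_mul, smul_eq_mul, ← sub_eq_zero,
    ← sub_mul] at h
  refine (mul_eq_zero.mp h).resolve_left (sub_ne_zero.mpr ?_)
  exact_mod_cast hne

variable (p) in
/-- The radial element of `Φ(ℚ_p)` of frequency `p ^ M`. -/
def radialKernel (M : ℤ) : PhiTime p := scaleKernel p M 0

lemma radialKernel_radial (M : ℤ) {s t : ℚ_[p]} (h : ‖s‖ = ‖t‖) :
    (radialKernel p M : ℚ_[p] → ℂ) s = (radialKernel p M : ℚ_[p] → ℂ) t := by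
  change scaleKernelFun p M 0 s = scaleKernelFun p M 0 t
  simp only [scaleKernelFun, Set.indicator, mem_closedBall_zero_iff, h]

lemma radialKernel_zero_ne_zero (M : ℤ) : (radialKernel p M : ℚ_[p] → ℂ) 0 ≠ 0 := by
  have hp0 := prime_cast_pos p
  change scaleKernelFun p M 0 0 ≠ 0
  rw [scaleKernelFun, Set.indicator_of_mem (mem_closedBall_self (zpow_pos hp0 _).le),
    Set.indicator_of_mem (mem_closedBall_self (zpow_pos hp0 _).le), volume_closedBall_padic,
    volume_closedBall_padic, sub_ne_zero]
  refine inv_injective.ne ?_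
  rw [Ne, Complex.ofReal_inj]
  refine (zpow_right_injective₀ hp0 (one_lt_prime_cast p).ne').ne ?_
  omega

/-- On a single frequency, a radial distribution is a multiple of the value at the origin. -/
lemma IsRadialDist.eq_smul {u : VectorDist p n} (hu : IsRadialDist u) {M : ℤ} {ψ : PhiTime p}
    (hψ : HasFrequency p M (ψ : ℚ_[p] → ℂ)) :
    u ψ = ((ψ : ℚ_[p] → ℂ) 0 / (radialKernel p M : ℚ_[p] → ℂ) 0) • u (radialKernel p M) := by
  have he := radialKernel_zero_ne_zero (p := p) M
  obtain ⟨ι, _, _, ε, hε, hrad⟩ := exists_radial_sum_dilate ψ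
  -- The constant makes the sum of dilates minus c times the kernel vanish at 0; being radial of one
  -- frequency, that combination is then zero.
  let c : ℂ := (Fintype.card ι : ℂ) * ((ψ : ℚ_[p] → ℂ) 0 / (radialKernel p M : ℚ_[p] → ℂ) 0)
  have hcard : (Fintype.card ι : ℂ) ≠ 0 := by exact_mod_cast Fintype.card_ne_zero
  have hsum : ∀ t, ((∑ i, dilate (ε i) (hε i) ψ : PhiTime p) : ℚ_[p] → ℂ) t =
      ∑ i, (ψ : ℚ_[p] → ℂ) (ε i * t) := by
    intro t
    rw [Submodule.coe_sum, Finset.sum_apply]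
    rfl
  have hfreq : HasFrequency p M
      ((∑ i, dilate (ε i) (hε i) ψ + (-c) • radialKernel p M : PhiTime p) : ℚ_[p] → ℂ) := by
    rw [Submodule.coe_add, Submodule.coe_sum, Submodule.coe_smul]
    exact (HasFrequency.sum _ fun i _ => hψ.comp_mul (hε i)).add
      ((hasFrequency_scaleKernelFun M 0).smul _)
  have happ : ∀ t,
      ((∑ i, dilate (ε i) (hε i) ψ + (-c) • radialKernel p M : PhiTime p) : ℚ_[p] → ℂ) t =
      ∑ i, (ψ : ℚ_[p] → ℂ) (ε i * t) + (-c) * (radialKernel p M : ℚ_[p] → ℂ) t := by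
    intro t
    rw [← hsum]
    rfl
  have hzero : (∑ i, dilate (ε i) (hε i) ψ + (-c) • radialKernel p M : PhiTime p) = 0 := by
    refine Subtype.ext (funext fun t => hfreq.eq_zero_of_radial (fun s t hst => ?_) ?_ t)
    · rw [happ, happ, hrad s t hst, radialKernel_radial M hst]
    · rw [happ]
      simp only [mul_zero, Finset.sum_const, Finset.card_univ, nsmul_eq_mul, c]
      field_simp
      ring
  have h := congrArg u hzero
  have hdil : ∀ i, u (dilate (ε i) (hε i) ψ) = u ψ := fun i => hu (ε i) (hε i) ψ _ rfl
  rw [map_add, map_sum, map_smul, map_zero] at h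
  simp only [hdil, Finset.sum_const, Finset.card_univ, ← Nat.cast_smul_eq_nsmul ℂ] at h
  rw [neg_smul, ← sub_eq_add_neg, sub_eq_zero, mul_smul] at h
  exact smul_right_injective _ hcard h

/-- Testing against the scale kernels shows that averages of g do not depend on the radius, so g is
constant; compact support makes the constant 0. -/
lemma eq_zero_of_forall_integral_eq_zero {g : ℚ_[p] → ℂ} (hg : g ∈ testSpace p ℚ_[p])
    (h : ∀ φ : PhiTime p, ∫ t, g t * (φ : ℚ_[p] → ℂ) t = 0) (t : ℚ_[p]) : g t = 0 := by
  obtain ⟨R, hR⟩ := exists_eq_zero_of_lt_norm hg.2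
  obtain ⟨s, hs⟩ := NormedField.exists_lt_norm ℚ_[p] R
  rw [← hR s hs]
  refine hg.1.eq_of_ballAvg_eq (fun N x => ?_) t s
  have := h (scaleKernel p N x)
  simp only [mul_comm (g _)] at this
  exact sub_eq_zero.mp ((integral_scaleKernelFun_mul N x hg.1.continuous).symm.trans this)

/-- φ has finitely many spatial frequencies, and each matches at most one temporal frequency. -/
lemma IsGeneralizedSolution.finite_support (hα : 0 < α) {u : VectorDist p n}
    (hu : IsGeneralizedSolution α β u) (φ : PhiSpace p n) :
    {M : ℤ | u (radialKernel p M) φ ≠ 0}.Finite := by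
  obtain ⟨S, hS, -⟩ := exists_sum_scaleProj φ
  refine (S.finite_toSet.biUnion (t := fun N : ℤ => {M : ℤ | ((p : ℝ) ^ M) ^ α =
    ((p : ℝ) ^ N) ^ β}) fun N _ => Set.Subsingleton.finite fun M hM M' hM' =>
      zpow_rpow_injective (p := p) hα (hM.trans hM'.symm)).subset fun M hM => ?_
  by_contra hnot
  refine hM ?_
  rw [hS, map_sum]
  refine Finset.sum_eq_zero fun N hN => hu.eq_zero_of_ne (hasFrequency_scaleKernelFun M 0)
    (hasFrequency_scaleProj N φ) fun heq => hnot ?_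
  exact Set.mem_biUnion (by exact_mod_cast hN) heq

/-- The function `t ↦ f(t)` that represents a radial generalized solution. -/
def representative (hα : 0 < α) {u : VectorDist p n} (hu : IsGeneralizedSolution α β u)
    (t : ℚ_[p]) : PhiSpaceDual p n where
  toFun φ := ∑ᶠ M : ℤ, (radialKernel p M : ℚ_[p] → ℂ) t / (radialKernel p M : ℚ_[p] → ℂ) 0 *
    u (radialKernel p M) φ
  map_add' φ ψ := by
    rw [← finsum_add_distrib]
    · simp only [map_add, mul_add]
    · exact (hu.finite_support hα φ).subset fun M hM h => hM (by simp [h])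
    · exact (hu.finite_support hα ψ).subset fun M hM h => hM (by simp [h])
  map_smul' c φ := by
    simp only [map_smul, smul_eq_mul, mul_left_comm _ c, RingHom.id_apply]
    rw [mul_finsum]

lemma representative_eq_sum (hα : 0 < α) {u : VectorDist p n} (hu : IsGeneralizedSolution α β u)
    {φ : PhiSpace p n} {T : Finset ℤ} (hT : ∀ M, M ∉ T → u (radialKernel p M) φ = 0)
    (t : ℚ_[p]) : representative hα hu t φ =
      ∑ M ∈ T, (radialKernel p M : ℚ_[p] → ℂ) t / (radialKernel p M : ℚ_[p] → ℂ) 0 *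
        u (radialKernel p M) φ := by
  refine finsum_eq_sum_of_support_subset _ fun M hM => ?_
  by_contra h
  exact hM (by simp [hT M h])

lemma exists_finset_support (hα : 0 < α) {u : VectorDist p n} (hu : IsGeneralizedSolution α β u)
    (φ : PhiSpace p n) : ∃ T : Finset ℤ, ∀ M, M ∉ T → u (radialKernel p M) φ = 0 := by
  refine ⟨(hu.finite_support hα φ).toFinset, fun M hM => ?_⟩
  by_contra h
  exact hM ((hu.finite_support hα φ).mem_toFinset.mpr h)

lemma isVectorTest_representative (hα : 0 < α) {u : VectorDist p n}
    (hu : IsGeneralizedSolution α β u) : IsVectorTest (representative hα hu) := by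
  intro φ
  obtain ⟨T, hT⟩ := exists_finset_support hα hu φ
  have : (fun t => representative hα hu t φ) =
      ∑ M ∈ T, (u (radialKernel p M) φ / (radialKernel p M : ℚ_[p] → ℂ) 0) •
        (radialKernel p M : ℚ_[p] → ℂ) := by
    ext t
    rw [representative_eq_sum hα hu hT, Finset.sum_apply]
    refine Finset.sum_congr rfl fun M _ => ?_
    rw [Pi.smul_apply, smul_eq_mul]
    ring
  rw [this]
  exact Submodule.sum_mem _ fun M _ => Submodule.smul_mem _ _ (radialKernel p M).2.1

/-- On each component of φ₁ only the value at 0 matters to u, and integration against the radial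
kernel yields this value. -/
lemma isGivenBy_representative (hα : 0 < α) {u : VectorDist p n}
    (hu : IsGeneralizedSolution α β u) (hrad : IsRadialDist u) :
    IsGivenBy u (representative hα hu) := by
  classical
  intro φ₁ φ₂
  obtain ⟨T, hT⟩ := exists_finset_support hα hu φ₂
  obtain ⟨S, hS, hS0⟩ := exists_sum_scaleProj φ₁
  have hi : ∀ M, Integrable fun t => (radialKernel p M : ℚ_[p] → ℂ) t * (φ₁ : ℚ_[p] → ℂ) t :=
    fun M => ((radialKernel p M).2.1.1.continuous.mul
      φ₁.2.1.1.continuous).integrable_of_hasCompactSupport φ₁.2.1.2.mul_left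
  have hval : ∀ M, u (scaleProj M φ₁) φ₂ =
      u (radialKernel p M) φ₂ / (radialKernel p M : ℚ_[p] → ℂ) 0 *
        ∫ t, (radialKernel p M : ℚ_[p] → ℂ) t * (φ₁ : ℚ_[p] → ℂ) t := by
    intro M
    rw [hrad.eq_smul (hasFrequency_scaleProj M φ₁), LinearMap.smul_apply, smul_eq_mul,
      radialKernel, integral_scaleKernel_mul]
    ring
  calc u φ₁ φ₂ = ∑ M ∈ S, u (scaleProj M φ₁) φ₂ := by
        conv_lhs => rw [hS, map_sum, LinearMap.sum_apply]
    _ = ∑ M ∈ S ∪ T, u (scaleProj M φ₁) φ₂ := by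
        refine Finset.sum_subset Finset.subset_union_left fun M _ hM => ?_
        rw [hS0 M hM, map_zero, LinearMap.zero_apply]
    _ = ∑ M ∈ S ∪ T, ∫ t, u (radialKernel p M) φ₂ / (radialKernel p M : ℚ_[p] → ℂ) 0 *
          ((radialKernel p M : ℚ_[p] → ℂ) t * (φ₁ : ℚ_[p] → ℂ) t) := by
        refine Finset.sum_congr rfl fun M _ => ?_
        rw [hval, integral_const_mul]
    _ = _ := by
        rw [← integral_finsetSum _ fun M _ => (hi M).const_mul _]
        congr 1
        ext t
        rw [representative_eq_sum hα hu (T := S ∪ T) fun M hM => hT M fun h =>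
          hM (Finset.mem_union_right S h), Finset.sum_mul]
        refine Finset.sum_congr rfl fun M _ => ?_
        ring

lemma eq_of_isGivenBy {u : VectorDist p n} {f g : ℚ_[p] → PhiSpaceDual p n}
    (hf : IsVectorTest f) (hg : IsVectorTest g) (huf : IsGivenBy u f) (hug : IsGivenBy u g) :
    g = f := by
  ext t φ
  have hi : ∀ {f : ℚ_[p] → PhiSpaceDual p n}, IsVectorTest f → ∀ φ₁ : PhiTime p,
      Integrable fun t => f t φ * (φ₁ : ℚ_[p] → ℂ) t := fun hf φ₁ =>
    ((hf φ).1.continuous.mul φ₁.2.1.1.continuous).integrable_of_hasCompactSupport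
      φ₁.2.1.2.mul_left
  refine sub_eq_zero.mp (eq_zero_of_forall_integral_eq_zero (g := fun t => g t φ - f t φ)
    (Submodule.sub_mem _ (hg φ) (hf φ)) (fun φ₁ => ?_) t)
  simp only [sub_mul]
  rw [integral_sub (hi hg φ₁) (hi hf φ₁), ← huf φ₁ φ, ← hug φ₁ φ, sub_self]

/-- Against a spatial component whose frequency matches M, the sum defining f(0) has only the term
M, with coefficient 1; against the others u already vanishes. -/
lemma radialKernel_eq_zero_of_representative_zero (hα : 0 < α) {u : VectorDist p n}
    (hu : IsGeneralizedSolution α β u) (h0 : representative hα hu 0 = 0) (M : ℤ) :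
    u (radialKernel p M) = 0 := by
  ext φ
  obtain ⟨S, hS, -⟩ := exists_sum_scaleProj φ
  rw [hS, map_sum, LinearMap.zero_apply]
  refine Finset.sum_eq_zero fun N _ => ?_
  by_cases hMN : ((p : ℝ) ^ M) ^ α = ((p : ℝ) ^ N) ^ β
  · have h := LinearMap.congr_fun h0 (scaleProj N φ)
    rw [representative_eq_sum hα hu (T := {M}), Finset.sum_singleton,
      div_self (radialKernel_zero_ne_zero M), one_mul] at h
    · exact h
    · intro M' hM'
      refine hu.eq_zero_of_ne (hasFrequency_scaleKernelFun M' 0) (hasFrequency_scaleProj N φ)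
        fun h' => hM' ?_
      exact Finset.mem_singleton.mpr (zpow_rpow_injective (p := p) hα (h'.trans hMN.symm))
  · exact hu.eq_zero_of_ne (hasFrequency_scaleKernelFun M 0) (hasFrequency_scaleProj N φ) hMN

lemma eq_zero_of_representative_zero (hα : 0 < α) {u : VectorDist p n}
    (hu : IsGeneralizedSolution α β u) (hrad : IsRadialDist u)
    (h0 : representative hα hu 0 = 0) : u = 0 ∧ ∀ t, representative hα hu t = 0 := by
  have hker := radialKernel_eq_zero_of_representative_zero hα hu h0
  have hf : ∀ t, representative hα hu t = 0 := by
    intro t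
    ext φ
    rw [representative_eq_sum hα hu (T := ∅) fun M _ => by rw [hker M, LinearMap.zero_apply]]
    rfl
  refine ⟨?_, hf⟩
  ext φ₁ φ₂
  rw [isGivenBy_representative hα hu hrad φ₁ φ₂]
  simp [hf]

end GeneralizedSolutions

end PadicWave

end

theorem theorem2 (p : ℕ) [Fact p.Prime] (n : ℕ) (hn : 1 ≤ n) (α β : ℝ) (hα : 0 < α) (hβ : 0 < β) :
    (∀ u : PadicWave.VectorDist p n,
      PadicWave.IsGeneralizedSolution α β u → PadicWave.IsRadialDist u →
        ∃ f : ℚ_[p] → PadicWave.PhiSpaceDual p n,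
          PadicWave.IsVectorTest f ∧ PadicWave.IsGivenBy u f ∧
          (∀ g : ℚ_[p] → PadicWave.PhiSpaceDual p n,
            PadicWave.IsVectorTest g → PadicWave.IsGivenBy u g → g = f) ∧
          (f 0 = 0 → u = 0 ∧ ∀ t, f t = 0)) ∧
    (∀ u v : ℚ_[p] → (Fin n → ℚ_[p]) → ℂ,
      PadicWave.IsRadialBoundedSolution α β u → PadicWave.IsRadialBoundedSolution α β v →
        (∀ x, u 0 x = v 0 x) → ∀ t x, u t x = v t x) := by
  refine ⟨fun u hu hrad => ⟨PadicWave.representative hα hu,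
    PadicWave.isVectorTest_representative hα hu,
    PadicWave.isGivenBy_representative hα hu hrad, fun g hg hug => ?_,
    PadicWave.eq_zero_of_representative_zero hα hu hrad⟩, fun u v hu hv => ?_⟩
  · exact PadicWave.eq_of_isGivenBy (PadicWave.isVectorTest_representative hα hu) hg
      (PadicWave.isGivenBy_representative hα hu hrad) hug
  · exact hu.eq_of_eq_zero_time hα hβ hv
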